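/- **Theorem (Precision indifference principle).** Fix $\lambda>1$, put $a=(\lambda-1)/2$ and $$\phi(t)=\frac{\sin((\pi+a)t)\,\sin(at)}{\pi a t^2}\ (t\neq 0),\qquad \phi(0)=1+\frac a\pi,\qquad C_\phi=\int_{\mathbb R}|\phi(t)|\,dt .$$ Let $BL$ be the set of measurable $g:\mathbb R\to\mathbb R$ with $|g(t)|\le 1$ and $(g\star\phi)(t)=g(t)$ for all $t$. For an integer $N\ge1$ (the oversampling factor) let $\tau=1/(\lambda N)$. A process $W=(W(t))_{t\in\mathbb R}$ is called *independent Gaussian noise of variance* $v\ge 0$ if its values at distinct times are independent, each with law $\mathcal N(0,v)$. Call $v>0$ *admissible* if, with $f_v$ the density of $\mathcal N(0,v)$, there is $\mu>0$ with $$\Bigl(1-\frac1{\sqrt2\,C_\phi^2}\Bigr)\frac1{f_v(C_\phi)}<\mu<\frac1{f_v(0)} .$$ 1. There is $v_0\ge 0$ such that every $v>v_0$ is admissible. (So noise of any finite variance becomes admissible after adding independent Gaussian dither of a suitable variance, and no dither is needed if the noise variance itself is admissible.) 2. For every admissible $v$ there are a constant $C$ and, for each $N$, an estimator $\widehat G_N:\{0,1\}^{\mathbb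 Z}\times\mathbb R\to\mathbb R$, measurable in its first argument, all depending only on $\lambda$ and $v$ (and $\widehat G_N$ on $N$), with the following property. Let $N\ge1$, $g\in BL$, $v_W,v_d\ge 0$ with $v_W+v_d=v$, and let $W,W_d$ be independent of each other and independent Gaussian noises of variances $v_W$ and $v_d$. From the one-bit samples $X(n)=\mathbf 1\bigl(g(n\tau)+W(n\tau)+W_d(n\tau)\ge0\bigr)$, $n\in\mathbb Z$, the estimate $\widehat G_{\text{1-bit}}(t)=\widehat G_N\bigl((X(n))_{n\in\mathbb Z},t\bigr)$ satisfies $$\sup_{t\in\mathbb R}\mathbb E\bigl|\widehat G_{\text{1-bit}}(t)-g(t)\bigr|^2\le\frac CN .$$ 3. This is the order attained from unquantized samples: there is a constant $K$, depending only on $\lambda$, such that for all $N\ge1$, all $g\in BL$, all $v_W\ge0$ and every independent Gaussian noise $W$ of variance $v_W$, the estimate $\widehat G_{\text{fr}}(t)=\tau\sum_{n\in\mathbb Z}[g(n\tau)+W(n\tau)]\,\phi(t-n\tau)$ satisfies $$\sup_{t\in\mathbb R}\mathbb E\bigl|\widehat G_{\text{fr}}(t)-g(t)\bigr|^2\le\frac{K\,v_W}{N}.$$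 -/

import Mathlib

open MeasureTheory ProbabilityTheory
open scoped NNReal ENNReal

universe u

/-- The stable interpolation kernel `φ` with stability constant `lam > 1`, where
`a = (lam - 1) / 2`. -/
noncomputable def stableKernel (lam t : ℝ) : ℝ :=
  let a := (lam - 1) / 2
  if t = 0 then 1 + a / Real.pi
  else Real.sin ((Real.pi + a) * t) * Real.sin (a * t) / (Real.pi * a * t ^ 2)

/-- The signals of interest: `|g| ≤ 1` everywhere and `g ⋆ φ = g` everywhere. -/
def bandlimitedSignals (lam : ℝ) : Set (ℝ → ℝ) :=
  {g | Measurable g ∧ (∀ t, |g t| ≤ 1) ∧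
    convolution g (stableKernel lam) (ContinuousLinearMap.mul ℝ ℝ) volume = g}

/-- The `L¹` norm of the kernel. -/
noncomputable def kernelL1 (lam : ℝ) : ℝ := ∫ t, |stableKernel lam t|

/-- The condition on the total variance `v` of noise plus dither: with `f` the `N(0, v)` density,
`δ = f(C_φ)` and `Δ = f(0)`, some `μ > 0` satisfies
`(1 - 1 / (√2 C_φ²)) / δ < μ < 1 / Δ`. -/
def VarianceCondition (lam : ℝ) (v : ℝ≥0) : Prop :=
  v ≠ 0 ∧ ∃ μ : ℝ, 0 < μ ∧
    (1 - 1 / (Real.sqrt 2 * kernelL1 lam ^ 2)) * (1 / gaussianPDFReal 0 v (kernelL1 lam)) < μ ∧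
    μ < 1 / gaussianPDFReal 0 v 0

/-- An additive independent Gaussian process: the values at distinct times are independent, each
with law `N(0, v)`. -/
def IsIndepGaussianNoise {Ω : Type*} [MeasurableSpace Ω] (P : Measure Ω) (W : ℝ → Ω → ℝ)
    (v : ℝ≥0) : Prop :=
  (∀ t, Measurable (W t)) ∧ iIndepFun W P ∧ ∀ t, P.map (W t) = gaussianReal 0 v

/-- Sampling interval `τ = 1 / (lam N)` at oversampling factor `N`. -/
noncomputable def sampleSpacing (lam : ℝ) (N : ℕ) : ℝ := 1 / (lam * N)

/-- The unquantized samples `Y(nτ)`, `n ∈ ℤ`, of a waveform `Y`. -/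
noncomputable def samples (lam : ℝ) (N : ℕ) (Y : ℝ → ℝ) (n : ℤ) : ℝ :=
  Y (n * sampleSpacing lam N)

/-- The single-bit samples `1(Y(nτ) ≥ 0)`, `n ∈ ℤ`, of a waveform `Y`. -/
noncomputable def oneBitSamples (lam : ℝ) (N : ℕ) (Y : ℝ → ℝ) (n : ℤ) : Bool :=
  decide (0 ≤ samples lam N Y n)

/-- The frame estimate `τ ∑ₙ y(n) φ(t - nτ)` from unquantized samples `y`. The factor
`τ = 1 / (lam N)` is the one that reproduces noiseless signals, since `∫ φ = 1`. -/
noncomputable def frameEstimate (lam : ℝ) (N : ℕ) (y : ℤ → ℝ) (t : ℝ) : ℝ :=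
  sampleSpacing lam N * ∑' n : ℤ, y n * stableKernel lam (t - n * sampleSpacing lam N)

/-- The distortion: maximum pointwise mean-squared error `sup_t E |G(t) - g(t)|²`. -/
noncomputable def distortion {Ω : Type*} [MeasurableSpace Ω] (P : Measure Ω)
    (G : Ω → ℝ → ℝ) (g : ℝ → ℝ) : ℝ≥0∞ :=
  ⨆ t : ℝ, ∫⁻ ω, ENNReal.ofReal (|G ω t - g t| ^ 2) ∂P

/-! The kernel `φ` is the Fourier transform of a trapezoid supported in `|ξ| ≤ 1/2 + a/π`. A product
`φ(u - s) φ(t - u)` therefore has its spectrum in `|ξ| ≤ 1 + 2a/π ≤ λ ≤ 1/τ`, and by Poisson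
summation its sum over the grid, times `τ`, equals its integral (`tsum_stableKernel_mul`). Inserting
`g = g ⋆ φ` at the grid points then gives `g(t) = τ ∑ g(nτ) φ(t - nτ)` for merely bounded `g`
(`hasSum_reproduction`). In the unquantized estimate only the noise is left as error; its terms are
orthogonal, so its mean square is at most `v_W τ² ∑ φ(t - nτ)² = O(v_W / N)`.

For one-bit samples let `p(y) = P(y + Z ≥ 0)` with `Z` of law `N(0, v)`, so that `E X(n) =
p(g(nτ))`. With `F` the frame operator on the grid, the true samples are a fixed point of `y ↦ F(y -
μ p(y) + μ p(g))`. The unknown `p(g)` is replaced by the observed bits and the map is iterated from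
`0`. On `[-1, 1]` the slope of `p` lies between `f_v(C_φ)` and `f_v(0)`, so `y - μ p(y)` has
Lipschitz constant `ρ = 1 - μ f_v(C_φ)` (`abs_relaxation_sub_le`). The norm of `F` is at most a
Riemann sum of `|φ|`, which tends to `C_φ`. Admissibility forces `ρ C_φ < 1`, hence a contraction
for all large `N` (`exists_contraction`). Each iteration also adds `μ F` applied to the centred
bits, which are bounded and orthogonal, at mean-square cost `O(1/N)`. The recursion in
`lintegral_sq_bitIterate_sub_le` keeps the accumulated error at that order. -/

open scoped FourierTransform

/-! ### The kernel as the Fourier transform of a trapezoid -/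

/-- The tent function of half-width `c`. -/
noncomputable def tent (c x : ℝ) : ℝ := max 0 (c - |x|)

lemma continuous_tent (c : ℝ) : Continuous (tent c) := by unfold tent; fun_prop

lemma tent_of_le {c x : ℝ} (h : c ≤ |x|) : tent c x = 0 := by
  unfold tent; exact max_eq_left (by linarith)

/-- The integrand has an elementary antiderivative on each half of the support. The values needed
are `z = -2πit`; the excluded `z = 0` is the area of the tent. -/
lemma integral_exp_mul_tent {c : ℝ} (hc : 0 ≤ c) {z : ℂ} (hz : z ≠ 0) :
    ∫ x : ℝ, Complex.exp (z * x) * (tent c x : ℂ) =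
      (Complex.exp (z * c) + Complex.exp (-(z * c)) - 2) / z ^ 2 := by
  have h1 : ∫ x : ℝ, Complex.exp (z * x) * (tent c x : ℂ) =
      ∫ x in (-c)..c, Complex.exp (z * x) * (tent c x : ℂ) := by
    rw [intervalIntegral.integral_of_le (by linarith)]
    symm
    apply setIntegral_eq_integral_of_forall_compl_eq_zero
    intro x hx
    rw [tent_of_le]
    · simp
    · by_contra! h
      exact hx ⟨(abs_lt.1 h).1, (abs_lt.1 h).2.le⟩
  have hcont : Continuous fun x : ℝ => Complex.exp (z * x) * (tent c x : ℂ) := by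
    have := continuous_tent c
    fun_prop
  have hid : ∀ x : ℝ, HasDerivAt (fun x : ℝ => (x : ℂ)) 1 x := fun x =>
    (hasDerivAt_id x).ofReal_comp
  have hexp : ∀ x : ℝ, HasDerivAt (fun x : ℝ => Complex.exp (z * x))
      (Complex.exp (z * x) * z) x := fun x => by
    simpa using ((hid x).const_mul z).cexp
  have h2 : ∫ x in (0 : ℝ)..c, Complex.exp (z * x) * (tent c x : ℂ) =
      Complex.exp (z * c) / z ^ 2 - (c / z + 1 / z ^ 2) := by
    have : ∀ x ∈ Set.uIcc 0 c, HasDerivAt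
        (fun x : ℝ => (c - x) * (Complex.exp (z * x) / z) + Complex.exp (z * x) / z ^ 2)
        (Complex.exp (z * x) * (tent c x : ℂ)) x := by
      intro x hx
      rw [Set.uIcc_of_le hc] at hx
      have ht : tent c x = c - x := by
        unfold tent; rw [abs_of_nonneg hx.1]; exact max_eq_right (by linarith [hx.2])
      convert! (((hid x).const_sub (c : ℂ)).mul ((hexp x).div_const z)).add
        ((hexp x).div_const (z ^ 2)) using 1
      rw [ht]; push_cast; field_simp; ring
    rw [intervalIntegral.integral_eq_sub_of_hasDerivAt this (hcont.intervalIntegrable _ _)]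
    simp [div_eq_mul_inv]
  have h3 : ∫ x in (-c)..0, Complex.exp (z * x) * (tent c x : ℂ) =
      c / z - 1 / z ^ 2 + Complex.exp (-(z * c)) / z ^ 2 := by
    have : ∀ x ∈ Set.uIcc (-c) 0, HasDerivAt
        (fun x : ℝ => (c + x) * (Complex.exp (z * x) / z) - Complex.exp (z * x) / z ^ 2)
        (Complex.exp (z * x) * (tent c x : ℂ)) x := by
      intro x hx
      rw [Set.uIcc_of_le (by linarith)] at hx
      have ht : tent c x = c + x := by
        unfold tent; rw [abs_of_nonpos hx.2]; rw [max_eq_right (by linarith [hx.1])]; ring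
      convert! (((hid x).const_add (c : ℂ)).mul ((hexp x).div_const z)).sub
        ((hexp x).div_const (z ^ 2)) using 1
      rw [ht]; push_cast; field_simp; ring
    rw [intervalIntegral.integral_eq_sub_of_hasDerivAt this (hcont.intervalIntegrable _ _)]
    simp; field_simp
  rw [h1, ← intervalIntegral.integral_add_adjacent_intervals
    (hcont.intervalIntegrable (-c) 0) (hcont.intervalIntegrable 0 c), h2, h3]
  field_simp; ring

lemma integral_tent {c : ℝ} (hc : 0 ≤ c) : ∫ x : ℝ, tent c x = c ^ 2 := by
  have h1 : ∫ x : ℝ, tent c x = ∫ x in (-c)..c, tent c x := by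
    rw [intervalIntegral.integral_of_le (by linarith)]
    symm
    apply setIntegral_eq_integral_of_forall_compl_eq_zero
    intro x hx
    rw [tent_of_le]
    by_contra! h
    exact hx ⟨(abs_lt.1 h).1, (abs_lt.1 h).2.le⟩
  have hcont := continuous_tent c
  have h2 : ∫ x in (0 : ℝ)..c, tent c x = c ^ 2 / 2 := by
    have : ∫ x in (0 : ℝ)..c, tent c x = ∫ x in (0 : ℝ)..c, (c - x) := by
      refine intervalIntegral.integral_congr fun x hx => ?_
      rw [Set.uIcc_of_le hc] at hx
      simp only [tent]; rw [abs_of_nonneg hx.1]; exact max_eq_right (by linarith [hx.2])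
    rw [this, intervalIntegral.integral_sub (by simp) (by simp)]
    simp; ring
  have h3 : ∫ x in (-c)..0, tent c x = c ^ 2 / 2 := by
    have : ∫ x in (-c)..0, tent c x = ∫ x in (-c)..0, (c + x) := by
      refine intervalIntegral.integral_congr fun x hx => ?_
      rw [Set.uIcc_of_le (by linarith)] at hx
      simp only [tent]; rw [abs_of_nonpos hx.2, max_eq_right (by linarith [hx.1])]; ring
    rw [this, intervalIntegral.integral_add (by simp) (by simp)]
    simp; ring
  rw [h1, ← intervalIntegral.integral_add_adjacent_intervals
    (hcont.intervalIntegrable (-c) 0) (hcont.intervalIntegrable 0 c), h2, h3]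
  ring

/-- The Fourier transform of the stable kernel: equal to `1` on `[-1/2, 1/2]` and decreasing
linearly to `0` at `±(1/2 + a / π)`. -/
noncomputable def trapezoid (lam x : ℝ) : ℝ :=
  Real.pi / ((lam - 1) / 2) *
    (tent (1 / 2 + (lam - 1) / 2 / Real.pi) x - tent (1 / 2) x)

lemma continuous_trapezoid (lam : ℝ) : Continuous (trapezoid lam) := by
  have := continuous_tent
  unfold trapezoid; fun_prop

lemma trapezoid_of_le {lam x : ℝ} (hlam : 1 < lam)
    (h : 1 / 2 + (lam - 1) / 2 / Real.pi ≤ |x|) : trapezoid lam x = 0 := by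
  have : 0 < (lam - 1) / 2 / Real.pi := by have := Real.pi_pos; have : 0 < lam - 1 := by linarith
                                           positivity
  unfold trapezoid
  rw [tent_of_le h, tent_of_le (by linarith)]; simp

lemma hasCompactSupport_tent (c : ℝ) : HasCompactSupport (tent c) := by
  apply HasCompactSupport.intro (isCompact_Icc (a := -c) (b := c))
  intro x hx
  apply tent_of_le
  by_contra! h
  exact hx ⟨(abs_lt.1 h).1.le, (abs_lt.1 h).2.le⟩

lemma integrable_tent (c : ℝ) : Integrable (tent c) :=
  (continuous_tent c).integrable_of_hasCompactSupport (hasCompactSupport_tent c)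

lemma integrable_trapezoid (lam : ℝ) : Integrable (trapezoid lam) :=
  ((integrable_tent _).sub (integrable_tent _)).const_mul _

/-- A trapezoid is a difference of two tents, so its transform is a difference of two cosines over
`t²`, and the sum formula turns this into a product of sines. At `t = 0` the areas of the tents are
compared instead. -/
lemma fourier_trapezoid {lam : ℝ} (hlam : 1 < lam) (t : ℝ) :
    𝓕 (fun x => (trapezoid lam x : ℂ)) t = (stableKernel lam t : ℂ) := by
  have hpi := Real.pi_pos
  obtain ⟨a, ha⟩ : ∃ a, a = (lam - 1) / 2 := ⟨_, rfl⟩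
  have ha0 : 0 < a := by rw [ha]; linarith
  rw [Real.fourier_real_eq_integral_exp_smul]
  unfold stableKernel trapezoid
  simp only [← ha]
  split_ifs with h0
  · subst h0
    simp only [mul_zero, Complex.ofReal_zero, zero_mul, Complex.exp_zero, one_smul]
    rw [integral_complex_ofReal, integral_const_mul, integral_sub (integrable_tent _)
      (integrable_tent _), integral_tent (by positivity), integral_tent (by positivity)]
    congr 1
    field_simp; ring
  · set z : ℂ := ((-2 * Real.pi * t : ℝ) : ℂ) * Complex.I with hzdef
    have hz : z ≠ 0 := by
      rw [hzdef]
      refine mul_ne_zero ?_ Complex.I_ne_zero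
      rw [Complex.ofReal_ne_zero]
      simp [h0, hpi.ne']
    have hint : ∀ c : ℝ, Integrable fun x : ℝ => Complex.exp (z * x) * (tent c x : ℂ) := by
      intro c
      have := continuous_tent c
      apply Continuous.integrable_of_hasCompactSupport (by fun_prop)
      apply HasCompactSupport.mul_left
      exact (hasCompactSupport_tent c).comp_left (g := fun x : ℝ => (x : ℂ)) (by simp)
    have : ∀ v : ℝ, Complex.exp (((-2 * Real.pi * v * t : ℝ) : ℂ) * Complex.I) •
        (((Real.pi / a * (tent (1 / 2 + a / Real.pi) v - tent (1 / 2) v)) : ℝ) : ℂ) =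
        ((Real.pi / a : ℝ) : ℂ) * (Complex.exp (z * v) * (tent (1 / 2 + a / Real.pi) v : ℂ) -
          Complex.exp (z * v) * (tent (1 / 2) v : ℂ)) := by
      intro v
      have : ((-2 * Real.pi * v * t : ℝ) : ℂ) * Complex.I = z * v := by
        rw [hzdef]; push_cast; ring
      rw [this, smul_eq_mul]; push_cast; ring
    simp_rw [this]
    rw [integral_const_mul, integral_sub (hint _) (hint _),
      integral_exp_mul_tent (by positivity) hz, integral_exp_mul_tent (by positivity) hz]
    have hcos : ∀ c : ℝ, Complex.exp (z * c) + Complex.exp (-(z * c)) =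
        ((2 * Real.cos (2 * Real.pi * t * c) : ℝ) : ℂ) := by
      intro c
      have e1 : z * c = -(((2 * Real.pi * t * c : ℝ) : ℂ) * Complex.I) := by
        rw [hzdef]; push_cast; ring
      rw [Complex.ofReal_mul, Complex.ofReal_cos, Complex.ofReal_ofNat, Complex.two_cos, e1]
      ring_nf
    have hz2 : z ^ 2 = ((-(2 * Real.pi * t) ^ 2 : ℝ) : ℂ) := by
      rw [hzdef, mul_pow, Complex.I_sq]; push_cast; ring
    rw [hcos, hcos, hz2]
    norm_cast
    -- With `A = (π + a)t` and `B = at`, what remains is `cos (A + B) - cos (A - B) = -2 sin A sin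
    -- B`.
    have e1 : 2 * Real.pi * t * (1 / 2 + a / Real.pi) = (Real.pi + a) * t + a * t := by
      field_simp; ring
    have e2 : 2 * Real.pi * t * (1 / 2) = (Real.pi + a) * t - a * t := by ring
    rw [e1, e2, Real.cos_add, Real.cos_sub]
    field_simp
    ring

/-- Fourier transforms of integrable functions are continuous, so the removable singularity at `0`
needs no separate limit. -/
lemma continuous_stableKernel {lam : ℝ} (hlam : 1 < lam) : Continuous (stableKernel lam) := by
  have h : Continuous (𝓕 (fun x => (trapezoid lam x : ℂ))) :=
    VectorFourier.fourierIntegral_continuous Real.continuous_fourierChar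
      (by exact continuous_inner) (integrable_trapezoid lam).ofReal
  have h2 : stableKernel lam = fun t => (𝓕 (fun x => (trapezoid lam x : ℂ)) t).re := by
    ext t; rw [fourier_trapezoid hlam]; simp
  rw [h2]
  exact Complex.continuous_re.comp h

lemma stableKernel_neg (lam t : ℝ) : stableKernel lam (-t) = stableKernel lam t := by
  unfold stableKernel; simp [mul_neg, Real.sin_neg]

lemma exists_stableKernel_bound {lam : ℝ} (hlam : 1 < lam) :
    ∃ K, 0 < K ∧ ∀ t, |stableKernel lam t| ≤ K * (1 + t ^ 2)⁻¹ := by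
  have hpi := Real.pi_pos
  have ha0 : 0 < (lam - 1) / 2 := by linarith
  have hb : ∀ t, |stableKernel lam t| ≤ ∫ x, |trapezoid lam x| := by
    intro t
    have := VectorFourier.norm_fourierIntegral_le_integral_norm Real.fourierChar volume
      (innerₗ ℝ) (fun x => (trapezoid lam x : ℂ)) t
    change ‖𝓕 (fun x => (trapezoid lam x : ℂ)) t‖ ≤ _ at this
    rw [fourier_trapezoid hlam] at this
    simpa using this
  -- The first summand bounds `|φ|`, the second `|φ| t²`; together they bound `|φ| (1 + t²)`.
  refine ⟨(∫ x, |trapezoid lam x|) + 1 / (Real.pi * ((lam - 1) / 2)), by positivity, fun t => ?_⟩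
  rw [← div_eq_mul_inv, le_div_iff₀ (by positivity)]
  have : |stableKernel lam t| * t ^ 2 ≤ 1 / (Real.pi * ((lam - 1) / 2)) := by
    unfold stableKernel
    simp only
    split_ifs with h
    · simp [h]; positivity
    · rw [abs_div, abs_mul, abs_of_pos (a := Real.pi * ((lam - 1) / 2) * t ^ 2) (by positivity),
        div_mul_eq_mul_div, div_le_div_iff₀ (by positivity) (by positivity)]
      have h1 := Real.abs_sin_le_one ((Real.pi + (lam - 1) / 2) * t)
      have h2 := Real.abs_sin_le_one ((lam - 1) / 2 * t)
      have h3 := mul_le_one₀ h1 (abs_nonneg _) h2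
      have h4 : 0 ≤ Real.pi * ((lam - 1) / 2) * t ^ 2 := by positivity
      nlinarith [mul_le_mul_of_nonneg_right h3 h4]
  nlinarith [hb t]

lemma integrable_stableKernel {lam : ℝ} (hlam : 1 < lam) : Integrable (stableKernel lam) := by
  obtain ⟨K, -, hK⟩ := exists_stableKernel_bound hlam
  exact (integrable_inv_one_add_sq.const_mul K).mono'
    (continuous_stableKernel hlam).aestronglyMeasurable (.of_forall hK)

/-! ### Poisson summation for band-limited products -/

/-- If the Fourier transform of a continuous integrable `f` is integrable, its integral is
`f 0`. -/
lemma integral_fourier_eq {f : ℝ → ℂ} (hc : Continuous f) (hf : Integrable f)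
    (hf' : Integrable (𝓕 f)) : ∫ x, 𝓕 f x = f 0 := by
  rw [← congrFun (hc.fourierInv_fourier_eq hf hf') 0, Real.fourierInv_eq]
  simp

lemma trapezoid_zero {lam : ℝ} (hlam : 1 < lam) : trapezoid lam 0 = 1 := by
  have hpi := Real.pi_pos
  have ha0 : 0 < (lam - 1) / 2 := by linarith
  unfold trapezoid tent
  rw [abs_zero, max_eq_right (by simp; positivity), max_eq_right (by norm_num)]
  have : lam - 1 ≠ 0 := by linarith
  field_simp; ring

lemma integral_stableKernel {lam : ℝ} (hlam : 1 < lam) : ∫ t, stableKernel lam t = 1 := by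
  have h := integral_fourier_eq (f := fun x => (trapezoid lam x : ℂ))
    (Complex.continuous_ofReal.comp (continuous_trapezoid lam)) (integrable_trapezoid lam).ofReal
    (by simp_rw [funext (fourier_trapezoid hlam)]; exact (integrable_stableKernel hlam).ofReal)
  simp_rw [fourier_trapezoid hlam, trapezoid_zero hlam] at h
  rw [integral_complex_ofReal] at h
  exact_mod_cast h

lemma one_le_kernelL1 {lam : ℝ} (hlam : 1 < lam) : 1 ≤ kernelL1 lam := by
  rw [← integral_stableKernel hlam]
  exact integral_mono (integrable_stableKernel hlam) (integrable_stableKernel hlam).abs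
    fun t => le_abs_self _

/-- Poisson summation at `0` for a compactly supported function, sampled at spacing `τ` below the
critical one. -/
lemma tsum_fourier_of_compactSupport {H : ℝ → ℂ} (hc : Continuous H) {B τ : ℝ}
    (hH : ∀ x, B ≤ |x| → H x = 0) (hτ : 0 < τ) (hB : B * τ ≤ 1)
    (hs : Summable fun n : ℤ => 𝓕 H (n * τ)) : τ * ∑' n : ℤ, 𝓕 H (n * τ) = H 0 := by
  have hF : ∀ y : ℝ, 𝓕 (fun x => H (x / τ)) y = τ * 𝓕 H (y * τ) := by
    intro y
    rw [Real.fourier_real_eq, Real.fourier_real_eq]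
    have := Measure.integral_comp_div
      (fun x : ℝ => Real.fourierChar (-(x * (y * τ))) • H x) τ
    rw [abs_of_pos hτ] at this
    have h2 : ∀ v : ℝ, v / τ * (y * τ) = v * y := fun v => by field_simp
    simp_rw [h2] at this
    rw [this]; simp
  have h0 : ∀ x : ℝ, B * τ ≤ |x| → H (x / τ) = 0 := by
    intro x hx
    apply hH
    rw [abs_div, abs_of_pos hτ, le_div_iff₀ hτ]; exact hx
  have key := Real.tsum_eq_tsum_fourier_of_rpow_decay_of_summable (f := fun x => H (x / τ))
    (by fun_prop) one_lt_two ?_ (by simp_rw [hF]; exact hs.mul_left _) 0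
  · simp_rw [hF] at key
    -- Since `B τ ≤ 1`, every nonzero integer lies at or beyond the edge of the support of `H(· /
    -- τ)`, where that function vanishes.
    rw [tsum_eq_single 0] at key
    · simp at key
      rw [key, tsum_mul_left]
    · intro n hn
      apply h0
      refine hB.trans ?_
      have : (1 : ℤ) ≤ |n| := Int.one_le_abs hn
      simp only [zero_add]
      exact_mod_cast this
  · apply Filter.EventuallyEq.trans_isBigO (f₂ := fun _ => 0) _ (Asymptotics.isBigO_zero _ _)
    have : ∀ᶠ x : ℝ in Filter.cocompact ℝ, x ∈ (Set.Icc (-1 : ℝ) 1)ᶜ :=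
      isCompact_Icc.compl_mem_cocompact
    filter_upwards [this] with x hx
    apply h0
    refine hB.trans ?_
    by_contra! h
    exact hx ⟨(abs_lt.1 h).1.le, (abs_lt.1 h).2.le⟩

/-- The trapezoid modulated to frequency `s`. -/
noncomputable def modTrapezoid (lam s x : ℝ) : ℂ := Real.fourierChar (s * x) • (trapezoid lam x : ℂ)

lemma continuous_modTrapezoid (lam s : ℝ) : Continuous (modTrapezoid lam s) := by
  have := continuous_trapezoid lam
  have := Real.continuous_fourierChar
  unfold modTrapezoid; fun_prop

lemma modTrapezoid_of_le {lam s x : ℝ} (hlam : 1 < lam)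
    (h : 1 / 2 + (lam - 1) / 2 / Real.pi ≤ |x|) : modTrapezoid lam s x = 0 := by
  simp [modTrapezoid, trapezoid_of_le hlam h]

lemma hasCompactSupport_modTrapezoid {lam : ℝ} (hlam : 1 < lam) (s : ℝ) :
    HasCompactSupport (modTrapezoid lam s) := by
  set c := 1 / 2 + (lam - 1) / 2 / Real.pi
  apply HasCompactSupport.intro (isCompact_Icc (a := -c) (b := c))
  intro x hx
  apply modTrapezoid_of_le hlam
  by_contra! h
  exact hx ⟨(abs_lt.1 h).1.le, (abs_lt.1 h).2.le⟩

lemma fourier_modTrapezoid {lam : ℝ} (hlam : 1 < lam) (s u : ℝ) :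
    𝓕 (modTrapezoid lam s) u = (stableKernel lam (u - s) : ℂ) := by
  rw [← fourier_trapezoid hlam, Real.fourier_real_eq, Real.fourier_real_eq]
  congr 1 with v
  rw [modTrapezoid, smul_smul, ← AddChar.map_add_eq_mul]
  congr 2; ring

/-- Both sides are the value at `0` of `H`, the convolution of two modulated trapezoids, whose
Fourier transform is the product of kernels: the integral by inversion, the sum by Poisson
summation, because the support of `H` is short enough for spacing `τ`. -/
lemma tsum_stableKernel_mul {lam τ : ℝ} (hlam : 1 < lam) (hτ : 0 < τ) (hτl : lam * τ ≤ 1)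
    (s t : ℝ)
    (hs : Summable fun n : ℤ => stableKernel lam (n * τ - s) * stableKernel lam (t - n * τ)) :
    τ * ∑' n : ℤ, stableKernel lam (n * τ - s) * stableKernel lam (t - n * τ) =
      ∫ u, stableKernel lam (u - s) * stableKernel lam (t - u) := by
  have hpi := Real.pi_gt_three
  have hi : ∀ s, Integrable (modTrapezoid lam s) := fun s =>
    (continuous_modTrapezoid lam s).integrable_of_hasCompactSupport
      (hasCompactSupport_modTrapezoid hlam s)
  set H := convolution (modTrapezoid lam s) (modTrapezoid lam t) (ContinuousLinearMap.mul ℂ ℂ)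
    volume with hHdef
  have hF : ∀ u : ℝ, 𝓕 H u =
      ((stableKernel lam (u - s) * stableKernel lam (t - u) : ℝ) : ℂ) := by
    intro u
    rw [hHdef, Real.fourier_mul_convolution_eq (hi s) (hi t), fourier_modTrapezoid hlam,
      fourier_modTrapezoid hlam, ← stableKernel_neg lam (t - u)]
    push_cast; simp
  have hHc : Continuous H :=
    (hasCompactSupport_modTrapezoid hlam t).continuous_convolution_right _
      (hi s).locallyIntegrable (continuous_modTrapezoid lam t)
  have hHi : Integrable H := (hi s).integrable_convolution _ (hi t)
  have hH0 : ∀ x, 2 * (1 / 2 + (lam - 1) / 2 / Real.pi) ≤ |x| → H x = 0 := by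
    intro x hx
    rw [hHdef, convolution_def]
    apply integral_eq_zero_of_ae (.of_forall fun y => ?_)
    simp only [ContinuousLinearMap.mul_apply', Pi.zero_apply]
    rcases le_total (1 / 2 + (lam - 1) / 2 / Real.pi) |y| with h | h
    · simp [modTrapezoid_of_le hlam h]
    · rw [modTrapezoid_of_le hlam (x := x - y), mul_zero]
      have := abs_sub_abs_le_abs_sub x y
      linarith
  have hFi : Integrable (𝓕 H) := by
    simp_rw [funext hF]
    apply Integrable.ofReal
    obtain ⟨K, hK0, hK⟩ := exists_stableKernel_bound hlam
    refine Integrable.bdd_mul (c := K) ((integrable_stableKernel hlam).comp_sub_left t)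
      ((continuous_stableKernel hlam).comp (by fun_prop)).aestronglyMeasurable
      (.of_forall fun u => (hK _).trans ?_)
    exact mul_le_of_le_one_right hK0.le (inv_le_one_of_one_le₀ (by nlinarith [sq_nonneg (u - s)]))
  have h1 := integral_fourier_eq hHc hHi hFi
  have hB : 2 * (1 / 2 + (lam - 1) / 2 / Real.pi) * τ ≤ 1 := by
    have : 2 * (1 / 2 + (lam - 1) / 2 / Real.pi) ≤ lam := by
      have : (lam - 1) / 2 / Real.pi ≤ (lam - 1) / 2 :=
        div_le_self (by linarith) (by linarith)
      linarith
    nlinarith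
  have h2 := tsum_fourier_of_compactSupport hHc hH0 hτ hB (by
    simp_rw [hF]; exact Complex.ofRealCLM.summable hs)
  rw [← h1] at h2
  simp_rw [hF] at h2
  rw [← Complex.ofReal_tsum, integral_complex_ofReal] at h2
  exact_mod_cast h2

/-! ### Riemann sums of the kernel -/

lemma inv_one_add_sq_le_of_abs_sub_le {x y : ℝ} (h : |x - y| ≤ 1) :
    (1 + x ^ 2)⁻¹ ≤ 3 * (1 + y ^ 2)⁻¹ := by
  rw [← div_eq_mul_inv, inv_eq_one_div, div_le_div_iff₀ (by positivity) (by positivity)]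
  have h1 : (x - y) ^ 2 ≤ 1 := by rw [sq_le_one_iff_abs_le_one]; exact h
  nlinarith [sq_nonneg (2 * x - y), sq_nonneg (x - y)]

lemma abs_sub_floor_mul_le {τ : ℝ} (hτ : 0 < τ) (x : ℝ) : |x - ⌊x / τ⌋ * τ| ≤ τ := by
  have h1 := Int.floor_le (x / τ)
  have h2 := Int.lt_floor_add_one (x / τ)
  rw [le_div_iff₀ hτ] at h1
  rw [div_lt_iff₀ hτ] at h2
  rw [abs_le]; constructor <;> nlinarith

/-- A step function with steps of length `τ` is integrated by a sum. -/
lemma hasSum_integral_step {τ : ℝ} (hτ : 0 < τ) {q : ℤ → ℝ}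
    (hi : Integrable fun x : ℝ => q ⌊x / τ⌋) :
    HasSum (fun n => τ * q n) (∫ x : ℝ, q ⌊x / τ⌋) := by
  have hset : ∀ n : ℤ, {x : ℝ | ⌊x / τ⌋ = n} = Set.Ico (n * τ) ((n + 1) * τ) := by
    intro n
    ext x
    simp only [Set.mem_ofPred_eq, Set.mem_Ico, Int.floor_eq_iff, le_div_iff₀ hτ, div_lt_iff₀ hτ]
  have hU : ⋃ n : ℤ, {x : ℝ | ⌊x / τ⌋ = n} = Set.univ := by ext x; simp
  have h := hasSum_integral_iUnion (μ := volume) (f := fun x : ℝ => q ⌊x / τ⌋)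
    (s := fun n : ℤ => {x : ℝ | ⌊x / τ⌋ = n})
    (fun n => by rw [hset]; exact measurableSet_Ico)
    (fun m n hmn => Set.disjoint_left.2 fun x hx hy => hmn (hx.symm.trans hy)) hi.integrableOn
  rw [hU, setIntegral_univ] at h
  convert! h using 2 with n
  rw [setIntegral_congr_fun (g := fun _ => q n) (by rw [hset]; exact measurableSet_Ico)
    (fun x hx => by simp only [Set.mem_ofPred_eq] at hx; simp [hx]), setIntegral_const, hset,
    Real.volume_real_Ico_of_le (by nlinarith)]
  simp; left; ring

lemma abs_step_le {τ K t : ℝ} (hτ : 0 < τ) (hτ1 : τ ≤ 1) {q : ℤ → ℝ} (hK : 0 ≤ K)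
    (hq : ∀ n : ℤ, |q n| ≤ K * (1 + (t - n * τ) ^ 2)⁻¹) (x : ℝ) :
    |q ⌊x / τ⌋| ≤ 3 * K * (1 + (t - x) ^ 2)⁻¹ := by
  refine (hq _).trans ?_
  have := inv_one_add_sq_le_of_abs_sub_le (x := t - ⌊x / τ⌋ * τ) (y := t - x) (by
    rw [sub_sub_sub_cancel_left]; exact (abs_sub_floor_mul_le hτ x).trans hτ1)
  nlinarith

lemma integrable_inv_one_add_sub_sq (t : ℝ) : Integrable fun x : ℝ => (1 + (t - x) ^ 2)⁻¹ :=
  integrable_inv_one_add_sq.comp_sub_left t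

lemma integrable_step {τ K t : ℝ} (hτ : 0 < τ) (hτ1 : τ ≤ 1) {q : ℤ → ℝ} (hK : 0 ≤ K)
    (hq : ∀ n : ℤ, |q n| ≤ K * (1 + (t - n * τ) ^ 2)⁻¹) : Integrable fun x : ℝ => q ⌊x / τ⌋ := by
  refine ((integrable_inv_one_add_sub_sq t).const_mul (3 * K)).mono' ?_
    (.of_forall (abs_step_le hτ hτ1 hK hq))
  have : Measurable fun x : ℝ => ⌊x / τ⌋ := Int.measurable_floor.comp (measurable_id.div_const τ)
  exact ((measurable_of_countable q).comp this).aestronglyMeasurable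

/-- The sum is the integral of a step function dominated by `3 / (1 + (t - x)²)`, which gives a
bound uniform in both `τ ≤ 1` and `t`. -/
lemma summable_and_tsum_inv_le {τ : ℝ} (hτ : 0 < τ) (hτ1 : τ ≤ 1) (t : ℝ) :
    Summable (fun n : ℤ => (1 + (t - n * τ) ^ 2)⁻¹) ∧
      τ * ∑' n : ℤ, (1 + (t - n * τ) ^ 2)⁻¹ ≤ 3 * Real.pi := by
  have hq : ∀ n : ℤ, |(1 + (t - n * τ) ^ 2)⁻¹| ≤ 1 * (1 + (t - n * τ) ^ 2)⁻¹ := fun n => by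
    rw [abs_of_nonneg (by positivity), one_mul]
  have hi := integrable_step (q := fun n : ℤ => (1 + (t - n * τ) ^ 2)⁻¹) hτ hτ1 zero_le_one hq
  have hs := hasSum_integral_step (q := fun n : ℤ => (1 + (t - n * τ) ^ 2)⁻¹) hτ hi
  refine ⟨(summable_mul_left_iff hτ.ne').1 hs.summable, ?_⟩
  rw [← tsum_mul_left, hs.tsum_eq]
  calc _ ≤ ∫ x : ℝ, 3 * (1 + (t - x) ^ 2)⁻¹ := by
        refine integral_mono hi ((integrable_inv_one_add_sub_sq t).const_mul 3) fun x => ?_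
        have := abs_step_le (q := fun n : ℤ => (1 + (t - n * τ) ^ 2)⁻¹) hτ hτ1 zero_le_one hq x
        simpa using (le_abs_self _).trans this
    _ = 3 * Real.pi := by
        rw [integral_const_mul, integral_sub_left_eq_self (fun x : ℝ => (1 + x ^ 2)⁻¹) volume t,
          integral_univ_inv_one_add_sq]

/-- The constant `K` bounds the kernel, its absolute Riemann sums and those of its square. -/
structure IsKernelSumBound (lam K : ℝ) : Prop where
  pos : 0 < K
  abs_le : ∀ t, |stableKernel lam t| ≤ K
  sum_le : ∀ τ, 0 < τ → τ ≤ 1 → ∀ t,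
    Summable (fun n : ℤ => |stableKernel lam (t - n * τ)|) ∧
    τ * ∑' n : ℤ, |stableKernel lam (t - n * τ)| ≤ K ∧
    τ * ∑' n : ℤ, stableKernel lam (t - n * τ) ^ 2 ≤ K

lemma exists_isKernelSumBound {lam : ℝ} (hlam : 1 < lam) : ∃ K, IsKernelSumBound lam K := by
  obtain ⟨K, hK0, hK⟩ := exists_stableKernel_bound hlam
  have hpi := Real.pi_gt_three
  have hK' : ∀ t, |stableKernel lam t| ≤ K := fun t => (hK t).trans
    (mul_le_of_le_one_right hK0.le (inv_le_one_of_one_le₀ (by nlinarith [sq_nonneg t])))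
  -- One constant for three bounds: `K` for the kernel, `3πK` for the absolute sums, and `K · 3πK`
  -- for the sums of squares by `φ² ≤ K |φ|`.
  refine ⟨K * (3 * Real.pi) * (1 + K), by positivity,
    fun t => (hK' t).trans (by nlinarith [mul_pos hK0 hK0]), fun τ hτ hτ1 t => ?_⟩
  obtain ⟨h1, h2⟩ := summable_and_tsum_inv_le hτ hτ1 t
  have hs : Summable fun n : ℤ => |stableKernel lam (t - n * τ)| :=
    (h1.mul_left K).of_nonneg_of_le (fun _ => abs_nonneg _) fun n => hK _
  have hb : τ * ∑' n : ℤ, |stableKernel lam (t - n * τ)| ≤ K * (3 * Real.pi) := by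
    have := hs.tsum_le_tsum (fun n : ℤ => hK (t - n * τ)) (h1.mul_left K)
    rw [tsum_mul_left] at this
    nlinarith
  refine ⟨hs, hb.trans (le_mul_of_one_le_right (by positivity) (by linarith)), ?_⟩
  have hsq : ∀ n : ℤ, stableKernel lam (t - n * τ) ^ 2 ≤ K * |stableKernel lam (t - n * τ)| := by
    intro n
    rw [← sq_abs, sq]
    exact mul_le_mul_of_nonneg_right (hK' _) (abs_nonneg _)
  have := ((hs.mul_left K).of_nonneg_of_le (fun _ => sq_nonneg _) hsq).tsum_le_tsum hsq
    (hs.mul_left K)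
  rw [tsum_mul_left] at this
  have h3 := mul_le_mul_of_nonneg_left hb hK0.le
  have h4 := mul_le_mul_of_nonneg_left this hτ.le
  have : 0 < K * (3 * Real.pi) := by positivity
  nlinarith

lemma sampleSpacing_pos {lam : ℝ} (hlam : 1 < lam) {N : ℕ} (hN : 1 ≤ N) :
    0 < sampleSpacing lam N := by
  have : (1 : ℝ) ≤ N := by exact_mod_cast hN
  unfold sampleSpacing; positivity

lemma lam_mul_sampleSpacing_le {lam : ℝ} (hlam : 1 < lam) {N : ℕ} (hN : 1 ≤ N) :
    lam * sampleSpacing lam N ≤ 1 := by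
  have : (1 : ℝ) ≤ N := by exact_mod_cast hN
  unfold sampleSpacing
  rw [mul_one_div, div_le_one (by positivity)]
  nlinarith

lemma sampleSpacing_le_inv {lam : ℝ} (hlam : 1 < lam) {N : ℕ} (hN : 1 ≤ N) :
    sampleSpacing lam N ≤ 1 / N := by
  have : (1 : ℝ) ≤ N := by exact_mod_cast hN
  unfold sampleSpacing
  apply one_div_le_one_div_of_le <;> nlinarith

lemma sampleSpacing_le_one {lam : ℝ} (hlam : 1 < lam) {N : ℕ} (hN : 1 ≤ N) :
    sampleSpacing lam N ≤ 1 := by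
  have := lam_mul_sampleSpacing_le hlam hN
  have := sampleSpacing_pos hlam hN
  nlinarith

/-- The Riemann sums of `|φ|` over the sampling grid converge to the `L¹` norm. -/
lemma tendsto_riemannSum_kernelL1 {lam : ℝ} (hlam : 1 < lam) :
    Filter.Tendsto (fun N : ℕ => sampleSpacing lam N *
      ∑' n : ℤ, |stableKernel lam (n * sampleSpacing lam N)|) Filter.atTop
      (nhds (kernelL1 lam)) := by
  obtain ⟨K, hK0, hK⟩ := exists_stableKernel_bound hlam
  have hq : ∀ τ : ℝ, ∀ n : ℤ,
      |(|stableKernel lam (n * τ)|)| ≤ K * (1 + (0 - n * τ) ^ 2)⁻¹ := by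
    intro τ n
    rw [abs_abs]; simpa using hK (n * τ)
  have hcong : ∀ᶠ N : ℕ in Filter.atTop,
      ∫ x : ℝ, |stableKernel lam (⌊x / sampleSpacing lam N⌋ * sampleSpacing lam N)| =
      sampleSpacing lam N * ∑' n : ℤ, |stableKernel lam (n * sampleSpacing lam N)| := by
    filter_upwards [Filter.eventually_ge_atTop 1] with N hN
    have hτ := sampleSpacing_pos hlam hN
    have := hasSum_integral_step hτ
      (integrable_step hτ (sampleSpacing_le_one hlam hN) hK0.le (hq (sampleSpacing lam N)))
    rw [← tsum_mul_left, this.tsum_eq]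
  refine Filter.Tendsto.congr' hcong ?_
  refine tendsto_integral_filter_of_dominated_convergence (fun x => 3 * K * (1 + (0 - x) ^ 2)⁻¹)
    ?_ ?_ ((integrable_inv_one_add_sub_sq 0).const_mul (3 * K)) (.of_forall fun x => ?_)
  · filter_upwards [Filter.eventually_ge_atTop 1] with N hN
    exact (integrable_step (sampleSpacing_pos hlam hN) (sampleSpacing_le_one hlam hN) hK0.le
      (hq (sampleSpacing lam N))).aestronglyMeasurable
  · filter_upwards [Filter.eventually_ge_atTop 1] with N hN
    exact .of_forall (abs_step_le (sampleSpacing_pos hlam hN) (sampleSpacing_le_one hlam hN)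
      hK0.le (hq (sampleSpacing lam N)))
  -- The grid point assigned to `x` is within `τ ≤ 1/N` of `x`, so continuity gives pointwise
  -- convergence.
  · refine ((continuous_stableKernel hlam).abs.tendsto x).comp ?_
    rw [tendsto_iff_dist_tendsto_zero]
    refine squeeze_zero' (.of_forall fun _ => dist_nonneg) ?_ tendsto_one_div_atTop_nhds_zero_nat
    filter_upwards [Filter.eventually_ge_atTop 1] with N hN
    rw [dist_comm, Real.dist_eq]
    exact (abs_sub_floor_mul_le (sampleSpacing_pos hlam hN) x).trans (sampleSpacing_le_inv hlam hN)

/-! ### Reproduction of signals from their samples -/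

/-- Signals in the class are reproduced exactly by the frame expansion from their samples. -/
lemma hasSum_reproduction {lam : ℝ} (hlam : 1 < lam) {N : ℕ} (hN : 1 ≤ N) {g : ℝ → ℝ}
    (hg : g ∈ bandlimitedSignals lam) (t : ℝ) :
    HasSum (fun n : ℤ => sampleSpacing lam N *
      (g (n * sampleSpacing lam N) * stableKernel lam (t - n * sampleSpacing lam N))) (g t) := by
  obtain ⟨hgm, hgb, hgc⟩ := hg
  have hτ := sampleSpacing_pos hlam hN
  have hτ1 := sampleSpacing_le_one hlam hN
  have hτl := lam_mul_sampleSpacing_le hlam hN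
  set τ := sampleSpacing lam N
  have hφ := integrable_stableKernel hlam
  have hconv : ∀ u, ∫ s, g s * stableKernel lam (u - s) = g u := fun u => by
    conv_rhs => rw [← hgc]
    rfl
  have hbdd : ∀ f : ℝ → ℝ, Integrable f → Integrable fun s => g s * f s := fun f hf =>
    hf.bdd_mul hgm.aestronglyMeasurable (.of_forall hgb)
  obtain ⟨K, hK0, hKb, hK⟩ := exists_isKernelSumBound hlam
  have hsum := (hK τ hτ hτ1 t).1
  -- Each sample is written as `g(nτ) = ∫ g(s) φ(nτ - s) ds`, and the sum over `n` is moved inside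
  -- the integral over `s`.
  have hF := hasSum_integral_of_summable_integral_norm (μ := volume)
    (F := fun (n : ℤ) s => τ * stableKernel lam (t - n * τ) * (g s * stableKernel lam (n * τ - s)))
    (fun n => (hbdd _ (hφ.comp_sub_left (n * τ))).const_mul _) (by
      refine (hsum.mul_left (τ * kernelL1 lam)).of_nonneg_of_le
        (fun n => integral_nonneg fun s => norm_nonneg _) fun n => ?_
      simp_rw [norm_mul, Real.norm_eq_abs]
      rw [integral_const_mul, abs_of_pos hτ]
      have : ∫ s, |g s| * |stableKernel lam (n * τ - s)| ≤ kernelL1 lam := by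
        unfold kernelL1
        rw [← integral_sub_left_eq_self (fun x => |stableKernel lam x|) volume (n * τ)]
        refine integral_mono_of_nonneg (.of_forall fun s => by positivity)
          (hφ.abs.comp_sub_left (n * τ)) (.of_forall fun s => ?_)
        exact mul_le_of_le_one_left (abs_nonneg _) (hgb s)
      have h2 : 0 ≤ τ * |stableKernel lam (t - n * τ)| := by positivity
      nlinarith)
  have hlhs : ∀ n : ℤ, ∫ s, τ * stableKernel lam (t - n * τ) *
      (g s * stableKernel lam (n * τ - s)) = τ * (g (n * τ) * stableKernel lam (t - n * τ)) := by
    intro n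
    rw [integral_const_mul, hconv]; ring
  simp_rw [hlhs] at hF
  convert! hF using 1
  have hrhs : ∀ s, ∑' n : ℤ, τ * stableKernel lam (t - n * τ) *
      (g s * stableKernel lam (n * τ - s)) =
      ∫ u, g s * (stableKernel lam (u - s) * stableKernel lam (t - u)) := by
    intro s
    rw [integral_const_mul, ← tsum_stableKernel_mul hlam hτ hτl s t, ← tsum_mul_left,
      ← tsum_mul_left]
    · congr 1 with n; ring
    · refine ((hsum.mul_left K).of_norm_bounded fun n => ?_)
      rw [norm_mul, Real.norm_eq_abs, Real.norm_eq_abs]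
      exact mul_le_mul_of_nonneg_right (hKb _) (abs_nonneg _)
  -- After the exchange of integrals the right side is `(g ⋆ φ) ⋆ φ` at `t`, and `g ⋆ φ = g` is used
  -- twice.
  simp_rw [hrhs]
  rw [integral_integral_swap]
  · have : ∀ u, ∫ s, g s * (stableKernel lam (u - s) * stableKernel lam (t - u)) =
        g u * stableKernel lam (t - u) := by
      intro u
      simp_rw [← mul_assoc]
      rw [integral_mul_const, hconv]
    simp_rw [this, hconv]
  · have h := (hφ.comp_sub_left t).convolution_integrand (ContinuousLinearMap.mul ℝ ℝ) hφ
    have h2 := h.bdd_mul (c := 1) (f := fun p : ℝ × ℝ => g p.1)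
      (hgm.comp measurable_fst).aestronglyMeasurable (.of_forall fun p => hgb _)
    refine h2.congr (.of_forall fun p => ?_)
    simp only [Function.uncurry, ContinuousLinearMap.mul_apply']
    rw [← stableKernel_neg lam (p.2 - p.1), neg_sub]
    ring

/-! ### Mean-square bounds for random series -/

/-- A weighted form of the Cauchy–Schwarz inequality for series. -/
lemma sq_tsum_mul_le {ι : Type*} {a e : ι → ℝ} (ha : Summable fun n => |a n|)
    {B : ℝ} (he : ∀ n, |e n| ≤ B) :
    (∑' n, a n * e n) ^ 2 ≤ (∑' n, |a n|) * ∑' n, |a n| * e n ^ 2 := by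
  have hs : Summable fun n => a n * e n := by
    refine (ha.mul_right B).of_norm_bounded fun n => ?_
    rw [Real.norm_eq_abs, abs_mul]
    exact mul_le_mul_of_nonneg_left (he n) (abs_nonneg _)
  have hs2 : Summable fun n => |a n| * e n ^ 2 := by
    refine (ha.mul_right (B ^ 2)).of_nonneg_of_le (fun n => by positivity) fun n => ?_
    refine mul_le_mul_of_nonneg_left ?_ (abs_nonneg _)
    rw [← sq_abs]
    exact pow_le_pow_left₀ (abs_nonneg _) (he n) 2
  refine le_of_tendsto (hs.hasSum.pow 2) (.of_forall fun s => ?_)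
  calc (∑ n ∈ s, a n * e n) ^ 2 ≤ (∑ n ∈ s, |a n|) * ∑ n ∈ s, |a n| * e n ^ 2 := by
        refine Finset.sum_sq_le_sum_mul_sum_of_sq_le_mul s (fun n _ => abs_nonneg _)
          (fun n _ => by positivity) fun n _ => ?_
        rw [mul_pow, ← sq_abs (a n)]; exact (by ring : _ = _).le
    _ ≤ _ := by
        refine mul_le_mul (ha.sum_le_tsum s fun n _ => abs_nonneg _)
          (hs2.sum_le_tsum s fun n _ => by positivity) (Finset.sum_nonneg fun n _ => by positivity)
          (tsum_nonneg fun n => abs_nonneg _)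

section SecondMoment

variable {Ω : Type*} [MeasurableSpace Ω] {P : Measure Ω}

/-- Minkowski's inequality for series in mean square. -/
lemma lintegral_sq_tsum_mul_le {ι : Type*} [Countable ι] {a : ι → ℝ}
    (ha : Summable fun n => |a n|) {e : ι → Ω → ℝ} (hm : ∀ n, Measurable (e n))
    {B : ℝ} (he : ∀ n ω, |e n ω| ≤ B) {M : ℝ}
    (heM : ∀ n, ∫⁻ ω, ENNReal.ofReal (e n ω ^ 2) ∂P ≤ ENNReal.ofReal M) :
    ∫⁻ ω, ENNReal.ofReal ((∑' n, a n * e n ω) ^ 2) ∂P ≤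
      ENNReal.ofReal ((∑' n, |a n|) ^ 2 * M) := by
  have hA : 0 ≤ ∑' n, |a n| := tsum_nonneg fun n => abs_nonneg _
  have hs2 : ∀ ω, Summable fun n => |a n| * e n ω ^ 2 := fun ω => by
    refine (ha.mul_right (B ^ 2)).of_nonneg_of_le (fun n => by positivity) fun n => ?_
    refine mul_le_mul_of_nonneg_left ?_ (abs_nonneg _)
    rw [← sq_abs]
    exact pow_le_pow_left₀ (abs_nonneg _) (he n ω) 2
  calc ∫⁻ ω, ENNReal.ofReal ((∑' n, a n * e n ω) ^ 2) ∂P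
      ≤ ∫⁻ ω, ENNReal.ofReal (∑' n, |a n|) *
          ∑' n, ENNReal.ofReal |a n| * ENNReal.ofReal (e n ω ^ 2) ∂P := by
        refine lintegral_mono fun ω => ?_
        refine (ENNReal.ofReal_le_ofReal (sq_tsum_mul_le ha fun n => he n ω)).trans ?_
        rw [ENNReal.ofReal_mul hA, ENNReal.ofReal_tsum_of_nonneg (fun n => by positivity) (hs2 ω)]
        simp_rw [ENNReal.ofReal_mul (abs_nonneg _)]
        exact le_rfl
    _ = ENNReal.ofReal (∑' n, |a n|) *
          ∑' n, ENNReal.ofReal |a n| * ∫⁻ ω, ENNReal.ofReal (e n ω ^ 2) ∂P := by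
        rw [lintegral_const_mul, lintegral_tsum]
        · congr 2 with n
          rw [lintegral_const_mul _ (by fun_prop)]
        · intro n; fun_prop
        · exact Measurable.tsum fun n => by fun_prop
    _ ≤ ENNReal.ofReal (∑' n, |a n|) *
          ∑' n, ENNReal.ofReal |a n| * ENNReal.ofReal M := by
        gcongr with n
        exact heM n
    _ = _ := by
        rw [ENNReal.tsum_mul_right, ← ENNReal.ofReal_tsum_of_nonneg (fun n => abs_nonneg _) ha,
          ← ENNReal.ofReal_mul hA, ← ENNReal.ofReal_mul hA]
        congr 1; ring

/-- From `|y| ≤ 1 + y²` the first absolute moments are at most `1 + s`, so the sum of absolute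
values has finite expectation. -/
lemma ae_summable_mul [IsProbabilityMeasure P] {ι : Type*} [Countable ι] {a : ι → ℝ}
    (ha : Summable fun n => |a n|) {Y : ι → Ω → ℝ} (hY : ∀ n, MemLp (Y n) 2 P) {s : ℝ}
    (hs : ∀ n, ∫ ω, Y n ω ^ 2 ∂P ≤ s) : ∀ᵐ ω ∂P, Summable fun n => a n * Y n ω := by
  have h1 : ∀ n, ∫⁻ ω, ‖a n * Y n ω‖ₑ ∂P ≤ ENNReal.ofReal (|a n| * (1 + s)) := by
    intro n
    have hint : Integrable (fun ω => a n * Y n ω) P :=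
      ((hY n).integrable one_le_two).const_mul _
    rw [← ofReal_integral_norm_eq_lintegral_enorm hint]
    refine ENNReal.ofReal_le_ofReal ?_
    simp_rw [norm_mul, Real.norm_eq_abs]
    rw [integral_const_mul]
    refine mul_le_mul_of_nonneg_left ?_ (abs_nonneg _)
    calc ∫ ω, |Y n ω| ∂P ≤ ∫ ω, (1 + Y n ω ^ 2) ∂P := by
          refine integral_mono ((hY n).integrable one_le_two).abs
            ((integrable_const _).add (hY n).integrable_sq) fun ω => ?_
          nlinarith [sq_abs (Y n ω), sq_nonneg (|Y n ω| - 1), abs_nonneg (Y n ω)]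
      _ ≤ 1 + s := by
          rw [integral_add (integrable_const _) (hY n).integrable_sq]
          simpa using hs n
  have h2 : ∫⁻ ω, ∑' n, ‖a n * Y n ω‖ₑ ∂P ≠ ∞ := by
    rw [lintegral_tsum fun n => ((hY n).aestronglyMeasurable.const_mul _).enorm]
    refine ne_top_of_le_ne_top ?_ (ENNReal.tsum_le_tsum h1)
    exact (ha.mul_right (1 + s)).tsum_ofReal_ne_top
  filter_upwards [ae_lt_top' (AEMeasurable.tsum fun n =>
    ((hY n).aestronglyMeasurable.const_mul _).enorm) h2] with ω hω
  exact Summable.of_nnnorm (ENNReal.tsum_coe_ne_top_iff_summable.1 hω.ne)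

/-- The mean square of a series of orthogonal random variables. -/
lemma lintegral_sq_tsum_orthogonal_le [IsProbabilityMeasure P] {ι : Type*} [Countable ι]
    {a : ι → ℝ} (ha : Summable fun n => |a n|) {Y : ι → Ω → ℝ} (hY : ∀ n, MemLp (Y n) 2 P)
    {s : ℝ} (hs : ∀ n, ∫ ω, Y n ω ^ 2 ∂P ≤ s)
    (horth : ∀ n m, n ≠ m → ∫ ω, Y n ω * Y m ω ∂P = 0) (ha2 : Summable fun n => a n ^ 2)
    (hs0 : 0 ≤ s) :
    ∫⁻ ω, ENNReal.ofReal ((∑' n, a n * Y n ω) ^ 2) ∂P ≤ ENNReal.ofReal (s * ∑' n, a n ^ 2) := by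
  have hpart : ∀ F : Finset ι, ∫⁻ ω, ENNReal.ofReal ((∑ n ∈ F, a n * Y n ω) ^ 2) ∂P ≤
      ENNReal.ofReal (s * ∑' n, a n ^ 2) := by
    intro F
    have hL : MemLp (fun ω => ∑ n ∈ F, a n * Y n ω) 2 P :=
      memLp_finsetSum _ fun n _ => (hY n).const_mul _
    rw [← ofReal_integral_eq_lintegral_ofReal hL.integrable_sq (.of_forall fun _ => sq_nonneg _)]
    refine ENNReal.ofReal_le_ofReal ?_
    have hexp : ∀ ω, (∑ n ∈ F, a n * Y n ω) ^ 2 =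
        ∑ n ∈ F, ∑ m ∈ F, a n * a m * (Y n ω * Y m ω) := by
      intro ω
      rw [sq, Finset.sum_mul_sum]
      refine Finset.sum_congr rfl fun n _ => Finset.sum_congr rfl fun m _ => by ring
    simp_rw [hexp]
    have hi : ∀ n m, Integrable (fun ω => a n * a m * (Y n ω * Y m ω)) P := fun n m =>
      ((hY n).integrable_mul (hY m)).const_mul _
    rw [integral_finsetSum _ fun n _ => integrable_finsetSum _ fun m _ => hi n m]
    have : ∀ n ∈ F, ∫ ω, ∑ m ∈ F, a n * a m * (Y n ω * Y m ω) ∂P ≤ s * a n ^ 2 := by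
      intro n hn
      rw [integral_finsetSum _ fun m _ => hi n m, Finset.sum_eq_single_of_mem n hn]
      · rw [integral_const_mul]
        simp_rw [← sq]
        rw [mul_comm]
        exact mul_le_mul_of_nonneg_right (hs n) (sq_nonneg _)
      · intro m _ hmn
        rw [integral_const_mul, horth n m hmn.symm, mul_zero]
    refine (Finset.sum_le_sum this).trans ?_
    rw [← Finset.mul_sum]
    exact mul_le_mul_of_nonneg_left (ha2.sum_le_tsum F fun n _ => sq_nonneg _) hs0
  -- Orthogonality bounds every finite partial sum; Fatou's lemma carries the bound to the series.
  calc ∫⁻ ω, ENNReal.ofReal ((∑' n, a n * Y n ω) ^ 2) ∂P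
      = ∫⁻ ω, Filter.liminf (fun F : Finset ι => ENNReal.ofReal ((∑ n ∈ F, a n * Y n ω) ^ 2))
          Filter.atTop ∂P := by
        refine lintegral_congr_ae ?_
        filter_upwards [ae_summable_mul ha hY hs] with ω hω
        exact (ENNReal.tendsto_ofReal (hω.hasSum.pow 2)).liminf_eq.symm
    _ ≤ Filter.liminf (fun F : Finset ι => ∫⁻ ω, ENNReal.ofReal ((∑ n ∈ F, a n * Y n ω) ^ 2) ∂P)
          Filter.atTop := by
        refine lintegral_liminf_le' fun F => ?_
        have := fun n => (hY n).aestronglyMeasurable.aemeasurable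
        fun_prop
    _ ≤ _ := by
        refine (Filter.liminf_le_liminf (.of_forall hpart)).trans ?_
        rw [Filter.liminf_const]

end SecondMoment

/-! ### Independence of sums, and admissible variances -/

/-- Conditioned on `(Y₁, Y₂)`, the two events concern `X₁` and `X₂` separately and their
probabilities multiply; independence of `Y₁` and `Y₂` then splits the outer integral. This makes
noise plus dither at two sample times independent. -/
lemma IndepFun.add_add_of_indepFun {Ω : Type*} [MeasurableSpace Ω] {P : Measure Ω}
    [IsProbabilityMeasure P] {X₁ X₂ Y₁ Y₂ : Ω → ℝ} (hX₁ : Measurable X₁) (hX₂ : Measurable X₂)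
    (hY₁ : Measurable Y₁) (hY₂ : Measurable Y₂) (hX : IndepFun X₁ X₂ P) (hY : IndepFun Y₁ Y₂ P)
    (hXY : IndepFun (fun ω => (X₁ ω, X₂ ω)) (fun ω => (Y₁ ω, Y₂ ω)) P) :
    IndepFun (fun ω => X₁ ω + Y₁ ω) (fun ω => X₂ ω + Y₂ ω) P := by
  have hXp := (indepFun_iff_map_prod_eq_prod_map_map hX₁.aemeasurable hX₂.aemeasurable).1 hX
  have hYp := (indepFun_iff_map_prod_eq_prod_map_map hY₁.aemeasurable hY₂.aemeasurable).1 hY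
  have hXYp := (indepFun_iff_map_prod_eq_prod_map_map (hX₁.prodMk hX₂).aemeasurable
    (hY₁.prodMk hY₂).aemeasurable).1 hXY
  have h1 := (indepFun_iff_map_prod_eq_prod_map_map hX₁.aemeasurable hY₁.aemeasurable).1
    (hXY.comp measurable_fst measurable_fst)
  have h2 := (indepFun_iff_map_prod_eq_prod_map_map hX₂.aemeasurable hY₂.aemeasurable).1
    (hXY.comp measurable_snd measurable_snd)
  have := Measure.isProbabilityMeasure_map (μ := P) hX₁.aemeasurable
  have := Measure.isProbabilityMeasure_map (μ := P) hX₂.aemeasurable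
  have := Measure.isProbabilityMeasure_map (μ := P) hY₁.aemeasurable
  have := Measure.isProbabilityMeasure_map (μ := P) hY₂.aemeasurable
  rw [indepFun_iff_measure_inter_preimage_eq_mul]
  intro s t hs ht
  have hmeas : ∀ {u : Set ℝ}, MeasurableSet u → MeasurableSet {p : ℝ × ℝ | p.1 + p.2 ∈ u} :=
    fun hu => (measurable_fst.add measurable_snd) hu
  have hsec : ∀ {ν : Measure ℝ} [IsProbabilityMeasure ν] {u : Set ℝ}, MeasurableSet u →
      Measurable fun c => ν {b | b + c ∈ u} := fun hu =>
    measurable_measure_prodMk_right (hmeas hu)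
  have hmarg : ∀ {X Y : Ω → ℝ}, Measurable X → Measurable Y →
      P.map (fun ω => (X ω, Y ω)) = (P.map X).prod (P.map Y) →
      IsProbabilityMeasure (P.map X) → IsProbabilityMeasure (P.map Y) →
      ∀ {u : Set ℝ}, MeasurableSet u →
      P ((fun ω => X ω + Y ω) ⁻¹' u) = ∫⁻ c, P.map X {b | b + c ∈ u} ∂(P.map Y) := by
    intro X Y hX hY h _ _ u hu
    have e : P ((fun ω => X ω + Y ω) ⁻¹' u) = P.map (fun ω => (X ω, Y ω)) {p | p.1 + p.2 ∈ u} :=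
      (Measure.map_apply (hX.prodMk hY) (hmeas hu)).symm
    rw [e, h, Measure.prod_apply_symm (hmeas hu)]
    rfl
  rw [hmarg hX₁ hY₁ h1 ‹_› ‹_› hs, hmarg hX₂ hY₂ h2 ‹_› ‹_› ht,
    ← lintegral_prod_mul (hsec hs).aemeasurable (hsec ht).aemeasurable, ← hYp]
  have hA : MeasurableSet {p : (ℝ × ℝ) × (ℝ × ℝ) | p.1.1 + p.2.1 ∈ s ∧ p.1.2 + p.2.2 ∈ t} :=
    MeasurableSet.inter
      ((by fun_prop : Measurable fun p : (ℝ × ℝ) × (ℝ × ℝ) => p.1.1 + p.2.1) hs)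
      ((by fun_prop : Measurable fun p : (ℝ × ℝ) × (ℝ × ℝ) => p.1.2 + p.2.2) ht)
  have e : P ((fun ω => X₁ ω + Y₁ ω) ⁻¹' s ∩ (fun ω => X₂ ω + Y₂ ω) ⁻¹' t) =
      P.map (fun ω => ((X₁ ω, X₂ ω), (Y₁ ω, Y₂ ω)))
        {p : (ℝ × ℝ) × (ℝ × ℝ) | p.1.1 + p.2.1 ∈ s ∧ p.1.2 + p.2.2 ∈ t} :=
    (Measure.map_apply ((hX₁.prodMk hX₂).prodMk (hY₁.prodMk hY₂)) hA).symm
  rw [e, hXYp, Measure.prod_apply_symm hA]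
  refine lintegral_congr fun y => ?_
  rw [hXp, ← Measure.prod_prod]
  rfl

lemma gaussianPDFReal_eq_mul_exp (v : ℝ≥0) (x : ℝ) :
    gaussianPDFReal 0 v x = gaussianPDFReal 0 v 0 * Real.exp (-x ^ 2 / (2 * v)) := by
  simp [gaussianPDFReal]

lemma gaussianPDFReal_le_of_abs_le (v : ℝ≥0) {x y : ℝ} (h : |x| ≤ |y|) :
    gaussianPDFReal 0 v y ≤ gaussianPDFReal 0 v x := by
  rw [gaussianPDFReal_eq_mul_exp v x, gaussianPDFReal_eq_mul_exp v y]
  have := sq_le_sq.2 h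
  refine mul_le_mul_of_nonneg_left (Real.exp_le_exp.2 ?_) (gaussianPDFReal_nonneg _ _ _)
  rw [neg_div, neg_div, neg_le_neg_iff]
  exact div_le_div_of_nonneg_right this (by positivity)

/-- A wide Gaussian is nearly flat on `[0, C_φ]`: `f_v(C_φ) / f_v(0) = exp(-C_φ² / 2v) ≥ 1 - C_φ² /
2v`, which exceeds `1 - 1 / (√2 C_φ²)` as soon as `v > C_φ⁴`. This leaves room for `μ`. -/
lemma varianceCondition_of_lt {lam : ℝ} (hlam : 1 < lam) {v : ℝ≥0}
    (hv : kernelL1 lam ^ 4 < v) : VarianceCondition lam v := by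
  have hC := one_le_kernelL1 hlam
  have hv0 : 0 < (v : ℝ) := lt_of_le_of_lt (by positivity) hv
  have hv' : v ≠ 0 := fun h => by simp [h] at hv0
  refine ⟨hv', ?_⟩
  have hΔ := gaussianPDFReal_pos 0 v 0 hv'
  have hδ := gaussianPDFReal_pos 0 v (kernelL1 lam) hv'
  have key : (1 - 1 / (Real.sqrt 2 * kernelL1 lam ^ 2)) *
      (1 / gaussianPDFReal 0 v (kernelL1 lam)) < 1 / gaussianPDFReal 0 v 0 := by
    rw [mul_one_div, div_lt_div_iff₀ hδ hΔ, gaussianPDFReal_eq_mul_exp v (kernelL1 lam), one_mul,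
      mul_comm]
    refine mul_lt_mul_of_pos_left ?_ hΔ
    have h1 := Real.add_one_le_exp (-kernelL1 lam ^ 2 / (2 * v))
    have h2 : kernelL1 lam ^ 2 / (2 * v) < 1 / (Real.sqrt 2 * kernelL1 lam ^ 2) := by
      have h3 : Real.sqrt 2 ≤ 2 := by
        rw [Real.sqrt_le_left (by norm_num)]; norm_num
      rw [div_lt_div_iff₀ (by positivity) (by positivity)]
      nlinarith [mul_le_mul_of_nonneg_right h3 (by positivity : 0 ≤ kernelL1 lam ^ 4)]
    rw [neg_div] at h1
    rw [neg_div]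
    linarith
  -- The lower bound may a priori be negative, so the maximum with `0` secures `μ > 0`.
  obtain ⟨μ, h1, h2⟩ := exists_between (max_lt key (one_div_pos.2 hΔ))
  exact ⟨μ, (le_max_right _ _).trans_lt h1, (le_max_left _ _).trans_lt h1, h2⟩

lemma exists_forall_varianceCondition {lam : ℝ} (hlam : 1 < lam) :
    ∃ v₀ : ℝ≥0, ∀ v : ℝ≥0, v₀ < v → VarianceCondition lam v := by
  have hC := one_le_kernelL1 hlam
  refine ⟨⟨kernelL1 lam ^ 4, by positivity⟩, fun v hv => varianceCondition_of_lt hlam ?_⟩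
  exact_mod_cast hv

/-! ### The mean response of a bit and the relaxed map -/

/-- `P(y + Z ≥ 0)` for `Z` with law `N(0, v)`. -/
noncomputable def gaussianUpper (v : ℝ≥0) (y : ℝ) : ℝ := (gaussianReal 0 v).real (Set.Ici (-y))

lemma gaussianUpper_sub {v : ℝ≥0} (hv : v ≠ 0) {x y : ℝ} (h : x ≤ y) :
    gaussianUpper v y - gaussianUpper v x = ∫ s in Set.Ico (-y) (-x), gaussianPDFReal 0 v s := by
  have hu : Set.Ici (-y) = Set.Ico (-y) (-x) ∪ Set.Ici (-x) :=
    (Set.Ico_union_Ici_eq_Ici (by linarith)).symm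
  have hd : Disjoint (Set.Ico (-y) (-x)) (Set.Ici (-x)) :=
    Set.disjoint_left.2 fun s hs hs' => absurd hs.2 (not_lt.2 hs')
  unfold gaussianUpper
  rw [hu, measureReal_union hd
    measurableSet_Ici, add_sub_cancel_right, measureReal_def,
    gaussianReal_apply_eq_integral _ hv, ENNReal.toReal_ofReal]
  exact setIntegral_nonneg measurableSet_Ico fun s _ => gaussianPDFReal_nonneg _ _ _

lemma gaussianUpper_sub_le {v : ℝ≥0} (hv : v ≠ 0) {x y : ℝ} (h : x ≤ y) :
    gaussianUpper v y - gaussianUpper v x ≤ gaussianPDFReal 0 v 0 * (y - x) := by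
  rw [gaussianUpper_sub hv h]
  calc ∫ s in Set.Ico (-y) (-x), gaussianPDFReal 0 v s
      ≤ ∫ _ in Set.Ico (-y) (-x), gaussianPDFReal 0 v 0 :=
        setIntegral_mono (integrable_gaussianPDFReal 0 v).integrableOn (by simp)
          fun s => gaussianPDFReal_le_of_abs_le v (by simp)
    _ = _ := by
        rw [setIntegral_const, Real.volume_real_Ico_of_le (by linarith), smul_eq_mul]; ring

lemma le_gaussianUpper_sub {v : ℝ≥0} (hv : v ≠ 0) {C x y : ℝ} (h : x ≤ y) (hx : -C ≤ x)
    (hy : y ≤ C) :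
    gaussianPDFReal 0 v C * (y - x) ≤ gaussianUpper v y - gaussianUpper v x := by
  rw [gaussianUpper_sub hv h]
  calc gaussianPDFReal 0 v C * (y - x) = ∫ _ in Set.Ico (-y) (-x), gaussianPDFReal 0 v C := by
        rw [setIntegral_const, Real.volume_real_Ico_of_le (by linarith), smul_eq_mul]; ring
    _ ≤ _ := by
        refine setIntegral_mono_on (by simp) (integrable_gaussianPDFReal 0 v).integrableOn
          measurableSet_Ico fun s hs => gaussianPDFReal_le_of_abs_le v ?_
        exact (abs_le.2 ⟨by linarith [hs.1], by linarith [hs.2]⟩).trans (le_abs_self C)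

/-- Truncation to `[-1, 1]`. -/
noncomputable def clip (y : ℝ) : ℝ := max (-1) (min y 1)

lemma clip_mem (y : ℝ) : -1 ≤ clip y ∧ clip y ≤ 1 :=
  ⟨le_max_left _ _, max_le (by norm_num) (min_le_right _ _)⟩

lemma clip_of_abs_le {y : ℝ} (h : |y| ≤ 1) : clip y = y := by
  have := abs_le.1 h
  rw [clip, min_eq_left this.2, max_eq_right this.1]

lemma clip_mono {x y : ℝ} (h : x ≤ y) : clip x ≤ clip y :=
  max_le_max le_rfl (min_le_min h le_rfl)

lemma clip_sub_le {x y : ℝ} (h : x ≤ y) : clip y - clip x ≤ y - x := by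
  unfold clip
  rcases max_cases (-1) (min y 1) with h1 | h1 <;> rcases max_cases (-1) (min x 1) with h2 | h2 <;>
  rcases min_cases y 1 with h3 | h3 <;> rcases min_cases x 1 with h4 | h4 <;> linarith

/-- The relaxed fixed-point map `y ↦ y - μ P(y + Z ≥ 0)`, after truncation. -/
noncomputable def relaxation (v : ℝ≥0) (μ y : ℝ) : ℝ := clip y - μ * gaussianUpper v (clip y)

lemma abs_relaxation_le {v : ℝ≥0} {μ : ℝ} (hμ : 0 ≤ μ) (y : ℝ) : |relaxation v μ y| ≤ 1 + μ := by
  have h1 := clip_mem y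
  have h2 : 0 ≤ gaussianUpper v (clip y) := measureReal_nonneg
  have h3 : gaussianUpper v (clip y) ≤ 1 := measureReal_le_one
  unfold relaxation
  rw [abs_le]
  constructor <;> nlinarith

lemma measurable_clip : Measurable clip := by unfold clip; fun_prop

/-- In the clipped variable the slope is `1 - μ f_v`. The condition `μ f_v(0) ≤ 1` keeps it
nonnegative, and `f_v ≥ f_v(C)` on `[-1, 1]` keeps it at most `1 - μ f_v(C)`. Clipping is itself
nonexpansive, so the estimate holds on all of `ℝ`, where the iterates may wander. -/
lemma abs_relaxation_sub_le {v : ℝ≥0} (hv : v ≠ 0) {μ C : ℝ} (hμ : 0 ≤ μ) (hC : 1 ≤ C)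
    (hμΔ : μ * gaussianPDFReal 0 v 0 ≤ 1) (x y : ℝ) :
    |relaxation v μ y - relaxation v μ x| ≤ (1 - μ * gaussianPDFReal 0 v C) * |y - x| := by
  wlog h : x ≤ y generalizing x y
  · rw [abs_sub_comm, abs_sub_comm y]
    exact this y x (le_of_not_ge h)
  have hc := clip_mono h
  have h1 := gaussianUpper_sub_le hv hc
  have h2 := le_gaussianUpper_sub hv hc (C := C) (by linarith [(clip_mem x).1])
    (by linarith [(clip_mem y).2])
  have h3 := clip_sub_le h
  have h4 : 0 ≤ 1 - μ * gaussianPDFReal 0 v C := by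
    have := gaussianPDFReal_le_of_abs_le v (x := 0) (y := C) (by simp)
    nlinarith
  have h5 : 0 ≤ clip y - clip x := by linarith
  have e : relaxation v μ y - relaxation v μ x =
      clip y - clip x - μ * (gaussianUpper v (clip y) - gaussianUpper v (clip x)) := by
    unfold relaxation; ring
  rw [e, abs_of_nonneg (a := y - x) (by linarith), abs_of_nonneg]
  · have := mul_le_mul_of_nonneg_left h2 hμ
    have := mul_le_mul_of_nonneg_left h3 h4
    nlinarith
  · have := mul_le_mul_of_nonneg_left h1 hμ
    nlinarith

lemma measurable_relaxation (v : ℝ≥0) (μ : ℝ) : Measurable (relaxation v μ) := by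
  have : Measurable (gaussianUpper v) := by
    have : Monotone (gaussianUpper v) := fun x y h =>
      measureReal_mono (Set.Ici_subset_Ici.2 (by linarith))
    exact this.measurable
  unfold relaxation
  exact measurable_clip.sub ((this.comp measurable_clip).const_mul μ)

/-! ### The frame operator and the fixed-point iteration -/

/-- The numerical value of a bit. -/
def bitValue (b : Bool) : ℝ := if b then 1 else 0

lemma bitValue_nonneg (b : Bool) : 0 ≤ bitValue b := by cases b <;> simp [bitValue]

lemma bitValue_le_one (b : Bool) : bitValue b ≤ 1 := by cases b <;> simp [bitValue]

/-- Iterates of the fixed-point estimator of the sample values from the bits `x`. -/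
noncomputable def bitIterate (lam : ℝ) (N : ℕ) (v : ℝ≥0) (μ : ℝ) (x : ℤ → Bool) : ℕ → ℤ → ℝ
  | 0, _ => 0
  | k + 1, m => frameEstimate lam N
      (fun n => relaxation v μ (bitIterate lam N v μ x k n) + μ * bitValue (x n))
      (m * sampleSpacing lam N)

section Frame

variable {lam : ℝ} {N : ℕ}

lemma summable_mul_stableKernel (hlam : 1 < lam) (hN : 1 ≤ N) {y : ℤ → ℝ} {B : ℝ}
    (hy : ∀ n, |y n| ≤ B) (t : ℝ) :
    Summable fun n : ℤ => y n * stableKernel lam (t - n * sampleSpacing lam N) := by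
  obtain ⟨K, -, -, hK⟩ := exists_isKernelSumBound hlam
  have hs := (hK _ (sampleSpacing_pos hlam hN) (sampleSpacing_le_one hlam hN) t).1
  refine (hs.mul_left B).of_norm_bounded fun n => ?_
  rw [norm_mul]
  exact mul_le_mul_of_nonneg_right (hy n) (abs_nonneg _)

lemma abs_frameEstimate_le (hlam : 1 < lam) {K : ℝ}
    (hK : IsKernelSumBound lam K)
    (hN : 1 ≤ N) {y : ℤ → ℝ} {B : ℝ} (hB : 0 ≤ B) (hy : ∀ n, |y n| ≤ B) (t : ℝ) :
    |frameEstimate lam N y t| ≤ B * K := by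
  have hτ := sampleSpacing_pos hlam hN
  obtain ⟨hs, h1, -⟩ := hK.sum_le _ hτ (sampleSpacing_le_one hlam hN) t
  unfold frameEstimate
  rw [abs_mul, abs_of_pos hτ]
  have h2 : |∑' n : ℤ, y n * stableKernel lam (t - n * sampleSpacing lam N)| ≤
      B * ∑' n : ℤ, |stableKernel lam (t - n * sampleSpacing lam N)| := by
    rw [← tsum_mul_left, ← Real.norm_eq_abs]
    refine tsum_of_norm_bounded (hs.mul_left B).hasSum fun n => ?_
    rw [norm_mul]
    exact mul_le_mul_of_nonneg_right (hy n) (abs_nonneg _)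
  have := mul_le_mul_of_nonneg_left h2 hτ.le
  have := mul_le_mul_of_nonneg_left h1 hB
  nlinarith

lemma measurable_frameEstimate (hlam : 1 < lam) (hN : 1 ≤ N) {α : Type*} [MeasurableSpace α]
    {y : α → ℤ → ℝ} (hm : ∀ n, Measurable fun x => y x n) {B : ℝ} (hy : ∀ x n, |y x n| ≤ B)
    (t : ℝ) : Measurable fun x => frameEstimate lam N (y x) t := by
  unfold frameEstimate
  refine Measurable.const_mul ?_ _
  exact measurable_of_tendsto_metrizable' Filter.atTop (f := fun (s : Finset ℤ) x =>
    ∑ n ∈ s, y x n * stableKernel lam (t - n * sampleSpacing lam N)) (fun s => by fun_prop)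
    (tendsto_pi_nhds.2 fun x => (summable_mul_stableKernel hlam hN (hy x) t).hasSum)

/-- Clipping makes the input of every frame sum bounded whatever the previous iterate, so the bound
is uniform in the step and in the bits. -/
lemma exists_abs_bitIterate_le (hlam : 1 < lam) (hN : 1 ≤ N) (v : ℝ≥0) {μ : ℝ} (hμ : 0 ≤ μ) :
    ∃ B, ∀ x k m, |bitIterate lam N v μ x k m| ≤ B := by
  obtain ⟨K, hK⟩ := exists_isKernelSumBound hlam
  have hK0 := hK.pos
  refine ⟨(1 + 2 * μ) * K, fun x k m => ?_⟩
  cases k with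
  | zero => simp only [bitIterate, abs_zero]; positivity
  | succ k =>
    rw [bitIterate]
    refine abs_frameEstimate_le hlam hK hN (by positivity) (fun n => ?_) _
    have h1 := abs_relaxation_le (v := v) hμ (bitIterate lam N v μ x k n)
    have h2 : |μ * bitValue (x n)| ≤ μ := by
      rw [abs_of_nonneg (mul_nonneg hμ (bitValue_nonneg _))]
      exact mul_le_of_le_one_right hμ (bitValue_le_one _)
    exact (abs_add_le _ _).trans (by linarith)

lemma measurable_bitIterate (hlam : 1 < lam) (hN : 1 ≤ N) (v : ℝ≥0) {μ : ℝ}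
    (hμ : 0 ≤ μ) (k : ℕ) (m : ℤ) : Measurable fun x => bitIterate lam N v μ x k m := by
  induction k generalizing m with
  | zero => exact measurable_const
  | succ k ih =>
    simp only [bitIterate]
    refine measurable_frameEstimate hlam hN (B := 1 + 2 * μ) (fun n => ?_) (fun x n => ?_) _
    · exact ((measurable_relaxation v μ).comp (ih n)).add
        (((measurable_of_countable bitValue).comp (measurable_pi_apply n)).const_mul μ)
    · have h1 := abs_relaxation_le (v := v) hμ (bitIterate lam N v μ x k n)
      have h2 : |μ * bitValue (x n)| ≤ μ := by
        rw [abs_of_nonneg (mul_nonneg hμ (bitValue_nonneg _))]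
        exact mul_le_of_le_one_right hμ (bitValue_le_one _)
      exact (abs_add_le _ _).trans (by linarith)

lemma frameEstimate_samples (hlam : 1 < lam) (hN : 1 ≤ N) {g : ℝ → ℝ}
    (hg : g ∈ bandlimitedSignals lam) (t : ℝ) :
    frameEstimate lam N (samples lam N g) t = g t := by
  unfold frameEstimate
  rw [← tsum_mul_left]
  exact (hasSum_reproduction hlam hN hg t).tsum_eq

lemma abs_samples_le {g : ℝ → ℝ} (hg : g ∈ bandlimitedSignals lam) (n : ℤ) :
    |samples lam N g n| ≤ 1 := hg.2.1 _

lemma frameEstimate_add {y z : ℤ → ℝ} {t : ℝ}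
    (hy : Summable fun n : ℤ => y n * stableKernel lam (t - n * sampleSpacing lam N))
    (hz : Summable fun n : ℤ => z n * stableKernel lam (t - n * sampleSpacing lam N)) :
    frameEstimate lam N (fun n => y n + z n) t =
      frameEstimate lam N y t + frameEstimate lam N z t := by
  unfold frameEstimate
  simp_rw [add_mul]
  rw [hy.tsum_add hz, mul_add]

end Frame

lemma frameEstimate_eq_tsum (lam : ℝ) (N : ℕ) (y : ℤ → ℝ) (t : ℝ) :
    frameEstimate lam N y t = ∑' n : ℤ,
      sampleSpacing lam N * stableKernel lam (t - n * sampleSpacing lam N) * y n := by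
  unfold frameEstimate
  rw [← tsum_mul_left]
  congr 1 with n; ring

/-! ### Mean-square error of the iteration -/

section MeanSquare

variable {lam : ℝ} {N : ℕ} {Ω : Type*} [MeasurableSpace Ω] {P : Measure Ω}

lemma summable_abs_frameCoeff (hlam : 1 < lam) (hN : 1 ≤ N) (t : ℝ) :
    Summable fun n : ℤ =>
      |sampleSpacing lam N * stableKernel lam (t - n * sampleSpacing lam N)| := by
  obtain ⟨K, -, -, hK⟩ := exists_isKernelSumBound hlam
  simp_rw [abs_mul]
  exact (hK _ (sampleSpacing_pos hlam hN) (sampleSpacing_le_one hlam hN) t).1.mul_left _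

lemma lintegral_sq_frameEstimate_le (hlam : 1 < lam) (hN : 1 ≤ N) {A t : ℝ}
    (hA : sampleSpacing lam N * ∑' n : ℤ, |stableKernel lam (t - n * sampleSpacing lam N)| ≤ A)
    {e : ℤ → Ω → ℝ} (hm : ∀ n, Measurable (e n)) {B : ℝ} (he : ∀ n ω, |e n ω| ≤ B) {M : ℝ}
    (hM : 0 ≤ M) (heM : ∀ n, ∫⁻ ω, ENNReal.ofReal (e n ω ^ 2) ∂P ≤ ENNReal.ofReal M) :
    ∫⁻ ω, ENNReal.ofReal (frameEstimate lam N (fun n => e n ω) t ^ 2) ∂P ≤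
      ENNReal.ofReal (A ^ 2 * M) := by
  have hτ := sampleSpacing_pos hlam hN
  simp_rw [frameEstimate_eq_tsum]
  refine (lintegral_sq_tsum_mul_le (summable_abs_frameCoeff hlam hN t) hm he heM).trans
    (ENNReal.ofReal_le_ofReal ?_)
  refine mul_le_mul_of_nonneg_right (pow_le_pow_left₀ (tsum_nonneg fun _ => abs_nonneg _) ?_ 2) hM
  simp_rw [abs_mul, abs_of_pos hτ]
  rwa [tsum_mul_left]

lemma lintegral_sq_frameEstimate_orthogonal_le [IsProbabilityMeasure P] (hlam : 1 < lam)
    (hN : 1 ≤ N) {K : ℝ} (hK : IsKernelSumBound lam K) {Y : ℤ → Ω → ℝ}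
    (hY : ∀ n, MemLp (Y n) 2 P) {s : ℝ} (hs : ∀ n, ∫ ω, Y n ω ^ 2 ∂P ≤ s)
    (horth : ∀ n m, n ≠ m → ∫ ω, Y n ω * Y m ω ∂P = 0) (hs0 : 0 ≤ s) (t : ℝ) :
    ∫⁻ ω, ENNReal.ofReal (frameEstimate lam N (fun n => Y n ω) t ^ 2) ∂P ≤
      ENNReal.ofReal (K * s / N) := by
  have hτ := sampleSpacing_pos hlam hN
  have hτN := sampleSpacing_le_inv hlam hN
  obtain ⟨hK0, hKb, hK⟩ := hK
  obtain ⟨h1, -, h2⟩ := hK _ hτ (sampleSpacing_le_one hlam hN) t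
  have hsq : Summable fun n : ℤ =>
      (sampleSpacing lam N * stableKernel lam (t - n * sampleSpacing lam N)) ^ 2 := by
    simp_rw [mul_pow]
    refine Summable.mul_left _ ((h1.mul_left K).of_nonneg_of_le (fun _ => sq_nonneg _) fun n => ?_)
    rw [← sq_abs, sq]
    exact mul_le_mul_of_nonneg_right (hKb _) (abs_nonneg _)
  simp_rw [frameEstimate_eq_tsum]
  refine (lintegral_sq_tsum_orthogonal_le (summable_abs_frameCoeff hlam hN t) hY hs horth hsq
    hs0).trans (ENNReal.ofReal_le_ofReal ?_)
  simp_rw [mul_pow]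
  rw [tsum_mul_left, mul_comm K, mul_div_assoc]
  refine mul_le_mul_of_nonneg_left ?_ hs0
  have h3 := mul_le_mul_of_nonneg_left h2 hτ.le
  have h4 := mul_le_mul_of_nonneg_right hτN hK0.le
  calc _ ≤ sampleSpacing lam N * K := by rw [sq, mul_assoc]; exact h3
    _ ≤ 1 / N * K := h4
    _ = K / N := by ring

/-- At grid points the norm of the frame operator is the same Riemann sum everywhere, and that sum
tends to `C_φ`. This is why the iteration runs on the grid; off it, only the cruder constant of
`IsKernelSumBound` is used. -/
lemma tsum_abs_stableKernel_grid (lam τ : ℝ) (m : ℤ) :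
    ∑' n : ℤ, |stableKernel lam (m * τ - n * τ)| = ∑' n : ℤ, |stableKernel lam (n * τ)| := by
  rw [← (Equiv.subLeft m).tsum_eq fun n : ℤ => |stableKernel lam (n * τ)|]
  congr 1 with n
  simp only [Equiv.subLeft_apply]
  push_cast; ring_nf

/-- The weights are chosen so that a term contracted by `κ` in root mean square costs `κ⁻¹ κ² = κ`
in the recursion. -/
lemma add_sq_le_div_add_div {κ : ℝ} (h0 : 0 < κ) (h1 : κ < 1) (x y : ℝ) :
    (x + y) ^ 2 ≤ κ⁻¹ * x ^ 2 + (1 - κ)⁻¹ * y ^ 2 := by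
  have h2 : 0 < 1 - κ := by linarith
  have : κ⁻¹ * x ^ 2 + (1 - κ)⁻¹ * y ^ 2 - (x + y) ^ 2 =
      ((1 - κ) * x - κ * y) ^ 2 / (κ * (1 - κ)) := by
    field_simp; ring
  have : 0 ≤ ((1 - κ) * x - κ * y) ^ 2 / (κ * (1 - κ)) := by positivity
  linarith

/-- With `M` the bound at step `k`, one step gives `κ M + b`: the first term from the contraction,
the second from the orthogonal centred bits. The fixed point of this affine recursion is `b / (1 -
κ)`. -/
lemma lintegral_sq_bitIterate_sub_le [IsProbabilityMeasure P] (hlam : 1 < lam) (hN : 1 ≤ N)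
    {K : ℝ} (hK : IsKernelSumBound lam K) {v : ℝ≥0} {μ ρ κ : ℝ} (hμ : 0 ≤ μ) (hρ0 : 0 ≤ ρ)
    (hρ : ∀ x y, |relaxation v μ y - relaxation v μ x| ≤ ρ * |y - x|) (hκ0 : 0 < κ) (hκ1 : κ < 1)
    (hκ : ρ * (sampleSpacing lam N *
      ∑' n : ℤ, |stableKernel lam (n * sampleSpacing lam N)|) ≤ κ)
    {g : ℝ → ℝ} (hg : g ∈ bandlimitedSignals lam) {X : Ω → ℤ → Bool} (hX : Measurable X)
    (hs : ∀ n, ∫ ω, (bitValue (X ω n) - gaussianUpper v (samples lam N g n)) ^ 2 ∂P ≤ 1)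
    (horth : ∀ n m, n ≠ m → ∫ ω, (bitValue (X ω n) - gaussianUpper v (samples lam N g n)) *
      (bitValue (X ω m) - gaussianUpper v (samples lam N g m)) ∂P = 0) (k : ℕ) (m : ℤ) :
    ∫⁻ ω, ENNReal.ofReal ((bitIterate lam N v μ (X ω) k m - samples lam N g m) ^ 2) ∂P ≤
      ENNReal.ofReal (κ ^ k + (1 - κ)⁻¹ * ((1 - κ)⁻¹ * (μ ^ 2 * (K / N)))) := by
  have hκ2 : 0 < 1 - κ := by linarith
  have hK0 := hK.1
  have hτ := sampleSpacing_pos hlam hN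
  set p : ℤ → ℝ := fun n => gaussianUpper v (samples lam N g n) with hp
  set b := (1 - κ)⁻¹ * (μ ^ 2 * (K / N)) with hb
  have hb0 : 0 ≤ b := by positivity
  have hYb : ∀ n ω, |bitValue (X ω n) - p n| ≤ 1 := fun n ω => by
    have h1 := bitValue_nonneg (X ω n)
    have h2 := bitValue_le_one (X ω n)
    have h3 : 0 ≤ p n := measureReal_nonneg
    have h4 : p n ≤ 1 := measureReal_le_one
    rw [abs_le]; constructor <;> linarith
  have hYm : ∀ n, Measurable fun ω => bitValue (X ω n) - p n := fun n =>
    ((measurable_of_countable bitValue).comp ((measurable_pi_apply n).comp hX)).sub_const _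
  have hYL : ∀ n, MemLp (fun ω => bitValue (X ω n) - p n) 2 P := fun n =>
    MemLp.of_bound (hYm n).aestronglyMeasurable 1 (.of_forall (hYb n))
  induction k generalizing m with
  | zero =>
    calc _ ≤ ∫⁻ _, 1 ∂P := by
          refine lintegral_mono fun ω => ?_
          rw [← ENNReal.ofReal_one]
          refine ENNReal.ofReal_le_ofReal ?_
          rw [bitIterate, zero_sub, neg_sq, sq_le_one_iff_abs_le_one]
          exact abs_samples_le hg m
      _ = ENNReal.ofReal 1 := by simp
      _ ≤ _ := ENNReal.ofReal_le_ofReal (by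
          rw [pow_zero]; exact le_add_of_nonneg_right (by positivity))
  | succ k ih =>
    obtain ⟨B, hB⟩ := exists_abs_bitIterate_le hlam hN v hμ
    set e : ℤ → Ω → ℝ := fun n ω =>
      relaxation v μ (bitIterate lam N v μ (X ω) k n) - relaxation v μ (samples lam N g n) with he
    have hem : ∀ n, Measurable (e n) := fun n =>
      ((measurable_relaxation v μ).comp
        ((measurable_bitIterate hlam hN v hμ k n).comp hX)).sub_const _
    have heb : ∀ n ω, |e n ω| ≤ 2 * (1 + μ) := fun n ω => by
      refine (abs_sub _ _).trans ?_
      have := abs_relaxation_le (v := v) hμ (bitIterate lam N v μ (X ω) k n)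
      have := abs_relaxation_le (v := v) hμ (samples lam N g n)
      linarith
    set M := κ ^ k + (1 - κ)⁻¹ * b with hMdef
    have hM0 : 0 ≤ M := by positivity
    have heM : ∀ n, ∫⁻ ω, ENNReal.ofReal (e n ω ^ 2) ∂P ≤ ENNReal.ofReal (ρ ^ 2 * M) := by
      intro n
      rw [ENNReal.ofReal_mul (sq_nonneg _)]
      refine le_trans ?_ (mul_le_mul_right (ih n) _)
      rw [← lintegral_const_mul' _ _ ENNReal.ofReal_ne_top]
      refine lintegral_mono fun ω => ?_
      rw [← ENNReal.ofReal_mul (sq_nonneg _)]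
      refine ENNReal.ofReal_le_ofReal ?_
      rw [← sq_abs (e n ω), ← sq_abs (bitIterate lam N v μ (X ω) k n - _), ← mul_pow]
      exact pow_le_pow_left₀ (abs_nonneg _) (hρ _ _) 2
    have hdecomp : ∀ ω, bitIterate lam N v μ (X ω) (k + 1) m - samples lam N g m =
        frameEstimate lam N (fun n => e n ω) (m * sampleSpacing lam N) +
        μ * frameEstimate lam N (fun n => bitValue (X ω n) - p n) (m * sampleSpacing lam N) := by
      intro ω
      have hsum1 := summable_mul_stableKernel hlam hN (abs_samples_le (N := N) hg)
        (m * sampleSpacing lam N)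
      have hsum2 := summable_mul_stableKernel hlam hN (fun n => heb n ω) (m * sampleSpacing lam N)
      have hsum3 := summable_mul_stableKernel hlam hN (y := fun n => μ * (bitValue (X ω n) - p n))
        (B := μ) (fun n => by
          rw [abs_mul, abs_of_nonneg hμ]; exact mul_le_of_le_one_right hμ (hYb n ω))
        (m * sampleSpacing lam N)
      -- The input is the true samples plus a contracted error plus `μ` times centred bits. Clipping
      -- fixes the true samples, and the frame sum reproduces them, so only the two error terms
      -- survive.
      have hfun : (fun n => relaxation v μ (bitIterate lam N v μ (X ω) k n) +
          μ * bitValue (X ω n)) =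
          fun n => samples lam N g n + (e n ω + μ * (bitValue (X ω n) - p n)) := by
        ext n
        have : relaxation v μ (samples lam N g n) = samples lam N g n - μ * p n := by
          rw [relaxation, clip_of_abs_le (abs_samples_le hg n)]
        simp only [he, this]; ring
      have hmul : frameEstimate lam N (fun n => μ * (bitValue (X ω n) - p n))
          (m * sampleSpacing lam N) = μ * frameEstimate lam N (fun n => bitValue (X ω n) - p n)
          (m * sampleSpacing lam N) := by
        unfold frameEstimate
        simp_rw [mul_assoc μ]
        rw [tsum_mul_left]; ring
      have hsum23 := hsum2.add hsum3
      simp_rw [← add_mul] at hsum23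
      rw [bitIterate, hfun, frameEstimate_add hsum1 hsum23, frameEstimate_add hsum2 hsum3,
        frameEstimate_samples hlam hN hg, hmul]
      simp only [samples]; ring
    set S : Ω → ℝ := fun ω => frameEstimate lam N (fun n => e n ω) (m * sampleSpacing lam N)
    set T : Ω → ℝ := fun ω =>
      frameEstimate lam N (fun n => bitValue (X ω n) - p n) (m * sampleSpacing lam N)
    have hSm : Measurable S := measurable_frameEstimate hlam hN hem (fun ω n => heb n ω) _
    set c := sampleSpacing lam N * ∑' n : ℤ, |stableKernel lam (n * sampleSpacing lam N)|
      with hc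
    have hc0 : 0 ≤ c := mul_nonneg hτ.le (tsum_nonneg fun _ => abs_nonneg _)
    have hS : ∫⁻ ω, ENNReal.ofReal (S ω ^ 2) ∂P ≤ ENNReal.ofReal (c ^ 2 * (ρ ^ 2 * M)) :=
      lintegral_sq_frameEstimate_le hlam hN (by rw [tsum_abs_stableKernel_grid]) hem heb
        (by positivity) heM
    have hT : ∫⁻ ω, ENNReal.ofReal (T ω ^ 2) ∂P ≤ ENNReal.ofReal (K * 1 / N) :=
      lintegral_sq_frameEstimate_orthogonal_le hlam hN hK hYL hs horth zero_le_one _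
    calc ∫⁻ ω, ENNReal.ofReal ((bitIterate lam N v μ (X ω) (k + 1) m - samples lam N g m) ^ 2) ∂P
        ≤ ∫⁻ ω, (ENNReal.ofReal κ⁻¹ * ENNReal.ofReal (S ω ^ 2) +
            ENNReal.ofReal ((1 - κ)⁻¹ * μ ^ 2) * ENNReal.ofReal (T ω ^ 2)) ∂P := by
          refine lintegral_mono fun ω => ?_
          rw [hdecomp, ← ENNReal.ofReal_mul (by positivity), ← ENNReal.ofReal_mul (by positivity),
            ← ENNReal.ofReal_add (by positivity) (by positivity)]
          refine ENNReal.ofReal_le_ofReal ((add_sq_le_div_add_div hκ0 hκ1 _ _).trans ?_)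
          rw [mul_pow, mul_assoc (1 - κ)⁻¹]
      _ = ENNReal.ofReal κ⁻¹ * ∫⁻ ω, ENNReal.ofReal (S ω ^ 2) ∂P +
            ENNReal.ofReal ((1 - κ)⁻¹ * μ ^ 2) * ∫⁻ ω, ENNReal.ofReal (T ω ^ 2) ∂P := by
          rw [lintegral_add_left (by fun_prop), lintegral_const_mul' _ _ ENNReal.ofReal_ne_top,
            lintegral_const_mul' _ _ ENNReal.ofReal_ne_top]
      _ ≤ ENNReal.ofReal κ⁻¹ * ENNReal.ofReal (c ^ 2 * (ρ ^ 2 * M)) +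
            ENNReal.ofReal ((1 - κ)⁻¹ * μ ^ 2) * ENNReal.ofReal (K * 1 / N) := by
          gcongr
      _ ≤ _ := by
          rw [← ENNReal.ofReal_mul (by positivity), ← ENNReal.ofReal_mul (by positivity),
            ← ENNReal.ofReal_add (by positivity) (by positivity)]
          refine ENNReal.ofReal_le_ofReal ?_
          have h1 : κ⁻¹ * (c ^ 2 * (ρ ^ 2 * M)) ≤ κ * M := by
            have h2 : (ρ * c) ^ 2 ≤ κ ^ 2 := pow_le_pow_left₀ (by positivity) hκ 2
            calc κ⁻¹ * (c ^ 2 * (ρ ^ 2 * M)) = κ⁻¹ * ((ρ * c) ^ 2 * M) := by ring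
              _ ≤ κ⁻¹ * (κ ^ 2 * M) := by gcongr
              _ = κ * M := by field_simp
          have h3 : (1 - κ)⁻¹ * μ ^ 2 * (K * 1 / N) = b := by rw [hb]; ring
          have h4 : κ * M + b = κ ^ (k + 1) + (1 - κ)⁻¹ * b := by
            rw [hMdef]; field_simp; ring
          rw [h3]
          linarith

end MeanSquare

/-! ### Moments of the noise and centred bits -/

section Noise

variable {Ω : Type*} [MeasurableSpace Ω] {P : Measure Ω}

lemma IsIndepGaussianNoise.integral_eq_zero {W : ℝ → Ω → ℝ} {v : ℝ≥0}
    (hW : IsIndepGaussianNoise P W v) (t : ℝ) : ∫ ω, W t ω ∂P = 0 := by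
  have := integral_map (hW.1 t).aemeasurable (f := fun x : ℝ => x)
    (by fun_prop : AEStronglyMeasurable (fun x : ℝ => x) (P.map (W t)))
  rw [← this, hW.2.2 t, integral_id_gaussianReal]

lemma IsIndepGaussianNoise.memLp {W : ℝ → Ω → ℝ} {v : ℝ≥0}
    (hW : IsIndepGaussianNoise P W v) (t : ℝ) : MemLp (W t) 2 P := by
  have h : MemLp (id : ℝ → ℝ) 2 (P.map (W t)) := by
    rw [hW.2.2 t]; exact memLp_id_gaussianReal 2
  exact (memLp_map_measure_iff (by fun_prop) (hW.1 t).aemeasurable).1 h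

lemma IsIndepGaussianNoise.integral_sq {W : ℝ → Ω → ℝ} {v : ℝ≥0}
    (hW : IsIndepGaussianNoise P W v) (t : ℝ) : ∫ ω, W t ω ^ 2 ∂P = v := by
  have h := variance_of_integral_eq_zero (hW.1 t).aemeasurable (hW.integral_eq_zero t)
  rw [← h, ← variance_id_map (hW.1 t).aemeasurable, hW.2.2 t, variance_id_gaussianReal]

lemma IsIndepGaussianNoise.integral_mul {W : ℝ → Ω → ℝ} {v : ℝ≥0}
    (hW : IsIndepGaussianNoise P W v) {s t : ℝ} (hst : s ≠ t) :
    ∫ ω, W s ω * W t ω ∂P = 0 := by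
  rw [(hW.2.1.indepFun hst).integral_fun_mul_eq_mul_integral
    (hW.1 s).aestronglyMeasurable (hW.1 t).aestronglyMeasurable, hW.integral_eq_zero s, zero_mul]

lemma IsIndepGaussianNoise.map_add {W Wd : ℝ → Ω → ℝ} {v vd : ℝ≥0}
    (hW : IsIndepGaussianNoise P W v) (hWd : IsIndepGaussianNoise P Wd vd)
    (hind : IndepFun (fun ω t => W t ω) (fun ω t => Wd t ω) P) (t : ℝ) :
    P.map (fun ω => W t ω + Wd t ω) = gaussianReal 0 (v + vd) := by
  have h : IndepFun (W t) (Wd t) P :=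
    hind.comp (measurable_pi_apply t) (measurable_pi_apply t)
  have := gaussianReal_add_gaussianReal_of_indepFun h (hW.2.2 t) (hWd.2.2 t)
  rw [add_zero] at this
  exact this

lemma IsIndepGaussianNoise.indepFun_add [IsProbabilityMeasure P] {W Wd : ℝ → Ω → ℝ} {v vd : ℝ≥0}
    (hW : IsIndepGaussianNoise P W v) (hWd : IsIndepGaussianNoise P Wd vd)
    (hind : IndepFun (fun ω t => W t ω) (fun ω t => Wd t ω) P) {s t : ℝ} (hst : s ≠ t) :
    IndepFun (fun ω => W s ω + Wd s ω) (fun ω => W t ω + Wd t ω) P :=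
  IndepFun.add_add_of_indepFun (hW.1 s) (hW.1 t) (hWd.1 s) (hWd.1 t) (hW.2.1.indepFun hst)
    (hWd.2.1.indepFun hst) (hind.comp
      (φ := fun w : ℝ → ℝ => (w s, w t)) (ψ := fun w : ℝ → ℝ => (w s, w t))
      (by fun_prop) (by fun_prop))

/-- The centred bit `1(y + s ≥ 0) - P(y + Z ≥ 0)`, `Z` with law `N(0, v)`. -/
noncomputable def centredBit (v : ℝ≥0) (y s : ℝ) : ℝ :=
  bitValue (decide (0 ≤ y + s)) - gaussianUpper v y

lemma measurable_decide_nonneg_add (y : ℝ) : Measurable fun s : ℝ => decide (0 ≤ y + s) := by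
  refine measurable_to_bool ?_
  have : (fun s : ℝ => decide (0 ≤ y + s)) ⁻¹' {true} = Set.Ici (-y) := by
    ext s; simp [neg_le_iff_add_nonneg']
  rw [this]; exact measurableSet_Ici

lemma measurable_centredBit (v : ℝ≥0) (y : ℝ) : Measurable (centredBit v y) :=
  ((measurable_of_countable bitValue).comp (measurable_decide_nonneg_add y)).sub_const _

lemma abs_centredBit_le (v : ℝ≥0) (y s : ℝ) : |centredBit v y s| ≤ 1 := by
  have h1 := bitValue_nonneg (decide (0 ≤ y + s))
  have h2 := bitValue_le_one (decide (0 ≤ y + s))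
  have h3 : 0 ≤ gaussianUpper v y := measureReal_nonneg
  have h4 : gaussianUpper v y ≤ 1 := measureReal_le_one
  unfold centredBit
  rw [abs_le]; constructor <;> linarith

lemma integral_centredBit (v : ℝ≥0) (y : ℝ) : ∫ s, centredBit v y s ∂(gaussianReal 0 v) = 0 := by
  have h : ∀ s, bitValue (decide (0 ≤ y + s)) = (Set.Ici (-y)).indicator 1 s := by
    intro s
    by_cases hs : 0 ≤ y + s
    · rw [Set.indicator_of_mem (by simpa [neg_le_iff_add_nonneg'] using hs)]; simp [hs, bitValue]
    · rw [Set.indicator_of_notMem (by simpa [neg_le_iff_add_nonneg'] using hs)]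
      simp [hs, bitValue]
  unfold centredBit
  simp_rw [h]
  rw [integral_sub ((integrable_const _).indicator measurableSet_Ici) (integrable_const _),
    integral_indicator_one measurableSet_Ici]
  simp [gaussianUpper]

lemma integral_centredBit_comp {S : Ω → ℝ} (hS : Measurable S) {v : ℝ≥0}
    (hv : P.map S = gaussianReal 0 v) (y : ℝ) : ∫ ω, centredBit v y (S ω) ∂P = 0 := by
  rw [← integral_centredBit v y, ← hv, integral_map hS.aemeasurable
    (measurable_centredBit v y).aestronglyMeasurable]

end Noise

/-! ### Rates for both estimators -/

lemma sample_ne {lam : ℝ} (hlam : 1 < lam) {N : ℕ} (hN : 1 ≤ N) {n m : ℤ} (h : n ≠ m) :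
    (n * sampleSpacing lam N : ℝ) ≠ m * sampleSpacing lam N := fun h' =>
  h (by exact_mod_cast mul_right_cancel₀ (sampleSpacing_pos hlam hN).ne' h')

lemma distortion_frameEstimate_le {lam : ℝ} (hlam : 1 < lam) {K : ℝ} (hK : IsKernelSumBound lam K)
    {N : ℕ} (hN : 1 ≤ N) {g : ℝ → ℝ} (hg : g ∈ bandlimitedSignals lam) {vW : ℝ≥0} {Ω : Type*}
    [MeasurableSpace Ω] {P : Measure Ω} [IsProbabilityMeasure P] {W : ℝ → Ω → ℝ}
    (hW : IsIndepGaussianNoise P W vW) :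
    distortion P (fun ω => frameEstimate lam N (samples lam N fun t => g t + W t ω)) g ≤
      ENNReal.ofReal (K * vW / N) := by
  refine iSup_le fun t => ?_
  have hL : ∀ n : ℤ, MemLp (W (n * sampleSpacing lam N)) 2 P := fun n => hW.memLp _
  have hsq : ∀ n : ℤ, ∫ ω, W (n * sampleSpacing lam N) ω ^ 2 ∂P ≤ vW := fun n =>
    (hW.integral_sq _).le
  refine le_of_eq_of_le (lintegral_congr_ae ?_) (lintegral_sq_frameEstimate_orthogonal_le hlam hN
    hK hL hsq (fun n m hnm => hW.integral_mul (sample_ne hlam hN hnm)) vW.2 t)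
  -- The noise is unbounded, so its frame series converges only almost surely. Elsewhere `tsum`
  -- defaults to `0` and the split into signal and noise could fail.
  filter_upwards [ae_summable_mul (summable_abs_frameCoeff hlam hN t) hL hsq] with ω hω
  have hs : Summable fun n : ℤ => W (n * sampleSpacing lam N) ω *
      stableKernel lam (t - n * sampleSpacing lam N) := by
    refine (summable_mul_left_iff (sampleSpacing_pos hlam hN).ne').1 (hω.congr fun n => ?_)
    ring
  have := frameEstimate_add (summable_mul_stableKernel hlam hN (abs_samples_le (N := N) hg) t) hs
  rw [frameEstimate_samples hlam hN hg] at this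
  rw [sq_abs]
  congr 2
  rw [sub_eq_iff_eq_add', ← this]
  rfl

/-- A relaxation parameter for which the fixed-point map contracts at all large oversampling
factors. -/
lemma exists_contraction {lam : ℝ} (hlam : 1 < lam) {v : ℝ≥0} (hv : VarianceCondition lam v) :
    ∃ μ ρ κ : ℝ, 0 ≤ μ ∧ 0 ≤ ρ ∧ 0 < κ ∧ κ < 1 ∧
      (∀ x y, |relaxation v μ y - relaxation v μ x| ≤ ρ * |y - x|) ∧
      ∃ N₀ : ℕ, 1 ≤ N₀ ∧ ∀ N, N₀ ≤ N → ρ * (sampleSpacing lam N *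
        ∑' n : ℤ, |stableKernel lam (n * sampleSpacing lam N)|) ≤ κ := by
  obtain ⟨hv0, μ, hμ, h1, h2⟩ := hv
  have hC := one_le_kernelL1 hlam
  set C := kernelL1 lam with hCdef
  have hΔ := gaussianPDFReal_pos 0 v 0 hv0
  have hδ := gaussianPDFReal_pos 0 v C hv0
  have hδΔ := gaussianPDFReal_le_of_abs_le v (x := 0) (y := C) (by simp)
  rw [lt_div_iff₀ hΔ] at h2
  rw [mul_one_div, div_lt_iff₀ hδ] at h1
  have hρ0 : 0 ≤ 1 - μ * gaussianPDFReal 0 v C := by nlinarith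
  -- The admissibility condition is stronger than what is used: `√2 C² ≥ C` because `C ≥ 1`, so `ρ <
  -- 1 / (√2 C²)` already gives `ρ C < 1`.
  have hρC : (1 - μ * gaussianPDFReal 0 v C) * C < 1 := by
    have h3 : 1 - μ * gaussianPDFReal 0 v C < 1 / (Real.sqrt 2 * C ^ 2) := by linarith
    have h4 : 1 / (Real.sqrt 2 * C ^ 2) ≤ 1 / C := by
      apply one_div_le_one_div_of_le (by linarith)
      have h5 : (1 : ℝ) ≤ Real.sqrt 2 := by rw [Real.one_le_sqrt]; norm_num
      have h6 : C ≤ C ^ 2 := by nlinarith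
      nlinarith [sq_nonneg C]
    have := h3.trans_le h4
    rwa [lt_div_iff₀ (by linarith)] at this
  obtain ⟨κ, hκ, hκ1⟩ := exists_between hρC
  have hκ0 : 0 < κ := lt_of_le_of_lt (mul_nonneg hρ0 (by linarith)) hκ
  have hlim := (tendsto_riemannSum_kernelL1 hlam).const_mul (1 - μ * gaussianPDFReal 0 v C)
  obtain ⟨N₀, hN₀⟩ := Filter.eventually_atTop.1 (hlim.eventually (eventually_le_nhds hκ))
  exact ⟨μ, _, κ, hμ.le, hρ0, hκ0, hκ1, abs_relaxation_sub_le hv0 hμ.le hC h2.le, N₀ + 1,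
    by omega, fun N hN => hN₀ N (by omega)⟩

lemma lintegral_sq_frameEstimate_bitIterate_le {lam : ℝ} (hlam : 1 < lam) {K : ℝ}
    (hK : IsKernelSumBound lam K) {v : ℝ≥0} {μ ρ κ : ℝ} (hμ : 0 ≤ μ) (hρ0 : 0 ≤ ρ)
    (hρ : ∀ x y, |relaxation v μ y - relaxation v μ x| ≤ ρ * |y - x|) (hκ0 : 0 < κ) (hκ1 : κ < 1)
    {N : ℕ} (hN : 1 ≤ N) (hκ : ρ * (sampleSpacing lam N *
      ∑' n : ℤ, |stableKernel lam (n * sampleSpacing lam N)|) ≤ κ) {k : ℕ}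
    (hk : κ ^ k ≤ 1 / N) {g : ℝ → ℝ} (hg : g ∈ bandlimitedSignals lam)
    {vW vd : ℝ≥0} (hvv : vW + vd = v) {Ω : Type*} [MeasurableSpace Ω] {P : Measure Ω}
    [IsProbabilityMeasure P] {W Wd : ℝ → Ω → ℝ} (hW : IsIndepGaussianNoise P W vW)
    (hWd : IsIndepGaussianNoise P Wd vd)
    (hind : IndepFun (fun ω t => W t ω) (fun ω t => Wd t ω) P) (t : ℝ) :
    ∫⁻ ω, ENNReal.ofReal (|frameEstimate lam N
        (bitIterate lam N v μ (oneBitSamples lam N fun t => g t + W t ω + Wd t ω) k) t -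
        g t| ^ 2) ∂P ≤
      ENNReal.ofReal (K ^ 2 * (1 + (1 - κ)⁻¹ * ((1 - κ)⁻¹ * (μ ^ 2 * K))) / N) := by
  have hκ2 : 0 < 1 - κ := by linarith
  have hK0 := hK.pos
  set X : Ω → ℤ → Bool := fun ω => oneBitSamples lam N fun t => g t + W t ω + Wd t ω with hXdef
  set S : ℤ → Ω → ℝ := fun n ω =>
    W (n * sampleSpacing lam N) ω + Wd (n * sampleSpacing lam N) ω with hSdef
  have hSm : ∀ n, Measurable (S n) := fun n => (hW.1 _).add (hWd.1 _)
  have hlaw : ∀ n, P.map (S n) = gaussianReal 0 v := fun n => by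
    rw [← hvv]; exact hW.map_add hWd hind _
  have hXS : ∀ ω n, X ω n = decide (0 ≤ samples lam N g n + S n ω) := fun ω n => by
    refine decide_eq_decide.2 ?_
    simp only [samples, hSdef, add_assoc]
  have hX : Measurable X := by
    refine measurable_pi_iff.2 fun n => ?_
    simp_rw [hXS]
    exact (measurable_decide_nonneg_add _).comp (hSm n)
  have hY : ∀ ω n, bitValue (X ω n) - gaussianUpper v (samples lam N g n) =
      centredBit v (samples lam N g n) (S n ω) := fun ω n => by rw [hXS]; rfl
  have hmse := lintegral_sq_bitIterate_sub_le (P := P) hlam hN hK hμ hρ0 hρ hκ0 hκ1 hκ hg hX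
    (fun n => by
      simp_rw [hY]
      calc ∫ ω, centredBit v (samples lam N g n) (S n ω) ^ 2 ∂P ≤ ∫ _, (1 : ℝ) ∂P := by
            refine integral_mono_of_nonneg (.of_forall fun _ => sq_nonneg _) (integrable_const _)
              (.of_forall fun ω => ?_)
            exact (sq_le_one_iff_abs_le_one _).2 (abs_centredBit_le _ _ _)
        _ = 1 := by simp)
    (fun n m hnm => by
      simp_rw [hY]
      have hindep := (hW.indepFun_add hWd hind (sample_ne hlam hN hnm)).comp
        (measurable_centredBit v (samples lam N g n)) (measurable_centredBit v (samples lam N g m))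
      have := hindep.integral_fun_mul_eq_mul_integral
        ((measurable_centredBit v _).comp (hSm n)).aestronglyMeasurable
        ((measurable_centredBit v _).comp (hSm m)).aestronglyMeasurable
      refine Eq.trans this ?_
      rw [show ∫ ω, (centredBit v (samples lam N g n) ∘ fun ω => W (n * sampleSpacing lam N) ω +
        Wd (n * sampleSpacing lam N) ω) ω ∂P = 0 from
          integral_centredBit_comp (hSm n) (hlaw n) _, zero_mul]) k
  obtain ⟨B, hB⟩ := exists_abs_bitIterate_le hlam hN v hμ
  have hb : ∀ n ω, |bitIterate lam N v μ (X ω) k n - samples lam N g n| ≤ B + 1 := fun n ω =>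
    (abs_sub _ _).trans (add_le_add (hB _ _ _) (abs_samples_le hg n))
  -- The grid estimates are extended to arbitrary `t` by one more frame sum, which costs a factor
  -- `K²` in mean square.
  have hfinal := lintegral_sq_frameEstimate_le (P := P) hlam hN (t := t)
    (hK.sum_le _ (sampleSpacing_pos hlam hN) (sampleSpacing_le_one hlam hN) t).2.1
    (e := fun n ω => bitIterate lam N v μ (X ω) k n - samples lam N g n)
    (fun n => ((measurable_bitIterate hlam hN v hμ k n).comp hX).sub_const _) hb
    (by positivity) hmse
  refine le_trans (le_of_eq (lintegral_congr fun ω => ?_))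
    (hfinal.trans (ENNReal.ofReal_le_ofReal ?_))
  · have := frameEstimate_add (summable_mul_stableKernel hlam hN (fun n => hb n ω) t)
      (summable_mul_stableKernel hlam hN (abs_samples_le (N := N) hg) t)
    simp only [sub_add_cancel] at this
    rw [frameEstimate_samples hlam hN hg] at this
    rw [sq_abs]
    congr 2
    exact sub_eq_iff_eq_add.2 this
  · rw [mul_div_assoc]
    refine mul_le_mul_of_nonneg_left ?_ (sq_nonneg _)
    have : (1 + (1 - κ)⁻¹ * ((1 - κ)⁻¹ * (μ ^ 2 * K))) / N =
      1 / N + (1 - κ)⁻¹ * ((1 - κ)⁻¹ * (μ ^ 2 * (K / N))) := by ring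
    rw [this]
    linarith

lemma exists_bitEstimator {lam : ℝ} (hlam : 1 < lam) {v : ℝ≥0} (hv : VarianceCondition lam v) :
    ∃ (C : ℝ) (Ghat : ℕ → (ℤ → Bool) → ℝ → ℝ),
      (∀ N t, Measurable fun x => Ghat N x t) ∧
      ∀ N : ℕ, 1 ≤ N → ∀ g ∈ bandlimitedSignals lam,
      ∀ vW vd : ℝ≥0, vW + vd = v →
      ∀ (Ω : Type u) [MeasurableSpace Ω] (P : Measure Ω) [IsProbabilityMeasure P]
        (W Wd : ℝ → Ω → ℝ),
        IsIndepGaussianNoise P W vW → IsIndepGaussianNoise P Wd vd →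
        IndepFun (fun ω t => W t ω) (fun ω t => Wd t ω) P →
        distortion P
          (fun ω => Ghat N (oneBitSamples lam N fun t => g t + W t ω + Wd t ω)) g
          ≤ ENNReal.ofReal (C / N) := by
  obtain ⟨μ, ρ, κ, hμ, hρ0, hκ0, hκ1, hρ, N₀, hN₀, hκ⟩ := exists_contraction hlam hv
  obtain ⟨K, hK⟩ := exists_isKernelSumBound hlam
  have hK0 := hK.pos
  have hκ2 : 0 < 1 - κ := by linarith
  -- The number of iterations depends on `N` so that the initial error has shrunk to `1/N`. The case
  -- `N = 0` is set aside because there `1 / N` is `0`.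
  have hexk : ∀ N : ℕ, ∃ k, 1 ≤ N → κ ^ k ≤ 1 / N := fun N => by
    by_cases hN : 1 ≤ N
    · have : (0 : ℝ) < 1 / N := by
        have : (1 : ℝ) ≤ N := by exact_mod_cast hN
        positivity
      obtain ⟨k, hk⟩ := exists_pow_lt_of_lt_one this hκ1
      exact ⟨k, fun _ => hk.le⟩
    · exact ⟨0, fun h => absurd h hN⟩
  choose k hk using hexk
  set D := K ^ 2 * (1 + (1 - κ)⁻¹ * ((1 - κ)⁻¹ * (μ ^ 2 * K))) with hD
  have hD0 : 0 ≤ D := by positivity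
  -- Below the threshold `N₀` the iteration need not contract, and the zero estimate is used: its
  -- squared error is at most `1 ≤ N₀ / N`, which accounts for the summand `N₀`.
  refine ⟨N₀ + D, fun N x t => if N₀ ≤ N then
    frameEstimate lam N (bitIterate lam N v μ x (k N)) t else 0, fun N t => ?_, ?_⟩
  · by_cases h : N₀ ≤ N
    · simp only [h, if_true]
      have hN := hN₀.trans h
      obtain ⟨B, hB⟩ := exists_abs_bitIterate_le hlam hN v hμ
      exact measurable_frameEstimate hlam hN (measurable_bitIterate hlam hN v hμ (k N))
        (fun x => hB x (k N)) t
    · simp only [h, if_false]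
      exact measurable_const
  · intro N hN g hg vW vd hvv Ω _ P _ W Wd hW hWd hind
    have hNpos : (0 : ℝ) < N := by exact_mod_cast hN
    refine iSup_le fun t => ?_
    by_cases h : N₀ ≤ N
    · simp only [h, if_true]
      refine (lintegral_sq_frameEstimate_bitIterate_le hlam hK hμ hρ0 hρ hκ0 hκ1 hN (hκ N h)
        (hk N hN) hg hvv hW hWd hind t).trans (ENNReal.ofReal_le_ofReal ?_)
      exact div_le_div_of_nonneg_right (by linarith [Nat.cast_nonneg (α := ℝ) N₀]) hNpos.le
    · simp only [h, if_false]
      calc ∫⁻ _, ENNReal.ofReal (|0 - g t| ^ 2) ∂P = ENNReal.ofReal (|0 - g t| ^ 2) := by simp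
        _ ≤ _ := by
          refine ENNReal.ofReal_le_ofReal ?_
          have h1 : |0 - g t| ^ 2 ≤ 1 := by
            rw [zero_sub, abs_neg]
            exact pow_le_one₀ (abs_nonneg _) (hg.2.1 t)
          refine h1.trans ?_
          rw [one_le_div hNpos]
          have : (N : ℝ) ≤ N₀ := by exact_mod_cast (not_le.1 h).le
          linarith

theorem mainTheorem1 (lam : ℝ) (hlam : 1 < lam) :
    -- every large enough total variance is admissible, so that any noise of finite variance
    -- can be dithered to an admissible one
    (∃ v₀ : ℝ≥0, ∀ v : ℝ≥0, v₀ < v → VarianceCondition lam v) ∧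
    -- estimation from single-bit samples; the estimator and the constant know only
    -- `lam` and the total variance `v`, and the estimator sees only the bits
    (∀ v : ℝ≥0, VarianceCondition lam v →
      ∃ (C : ℝ) (Ghat : ℕ → (ℤ → Bool) → ℝ → ℝ),
        (∀ N t, Measurable fun x => Ghat N x t) ∧
        ∀ N : ℕ, 1 ≤ N → ∀ g ∈ bandlimitedSignals lam,
        ∀ vW vd : ℝ≥0, vW + vd = v →
        ∀ (Ω : Type u) [MeasurableSpace Ω] (P : Measure Ω) [IsProbabilityMeasure P]
          (W Wd : ℝ → Ω → ℝ),
          IsIndepGaussianNoise P W vW → IsIndepGaussianNoise P Wd vd →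
          IndepFun (fun ω t => W t ω) (fun ω t => Wd t ω) P →
          distortion P
            (fun ω => Ghat N (oneBitSamples lam N fun t => g t + W t ω + Wd t ω)) g
            ≤ ENNReal.ofReal (C / N)) ∧
    -- the same order from unquantized samples, without dither
    (∃ K : ℝ, ∀ N : ℕ, 1 ≤ N → ∀ g ∈ bandlimitedSignals lam, ∀ vW : ℝ≥0,
        ∀ (Ω : Type u) [MeasurableSpace Ω] (P : Measure Ω) [IsProbabilityMeasure P]
          (W : ℝ → Ω → ℝ),
          IsIndepGaussianNoise P W vW →
          distortion P
            (fun ω => frameEstimate lam N (samples lam N fun t => g t + W t ω)) g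
            ≤ ENNReal.ofReal (K * vW / N)) := by
  refine ⟨exists_forall_varianceCondition hlam, fun v hv => exists_bitEstimator hlam hv, ?_⟩
  obtain ⟨K, hK⟩ := exists_isKernelSumBound hlam
  exact ⟨K, fun N hN g hg vW Ω _ P _ W hW => distortion_frameEstimate_le hlam hK hN hg hW⟩
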